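/- Let $\mathcal A$ be a connected (real or complex) Lie group with Lie algebra $\mathfrak a$, acting smoothly (holomorphically, if $\mathcal A$ is complex) by linear maps on a finite-dimensional complex vector space $W$, and let $\mathfrak a$ act on $W$ by the differential of this action. Let $w\in W$, $w\ne 0$, be a cyclic vector: the smallest complex subspace of $W$ that contains $w$ and is stable under $\mathfrak a$ is $W$. For $k\ge 0$ let $W^{[k]}\subset W^{\otimes k}$ be the $\mathfrak a$-submodule (complex subspace) generated by $w^{\otimes k}$, with $W^{[0]}=\mathbb C$. As subspaces of $W^{\otimes(i+j)}$ there are inclusions $m_{i,j}\colon W^{[i+j]}\hookrightarrow W^{[i]}\otimes W^{[j]}$. Let $W^{[*]}=\bigoplus_{k\ge 0}(W^{[k]})^*$ be the graded commutative algebra whose multiplication is given by the dual maps $m_{i,j}^*$. Let $P(W)=\operatorname{Proj} S^*(W^*)$ be the projective space of lines in $W$, and let $\mathcal N_w\subset P(W)$ be the Zariski closure of the $\mathcal A$-orbit of the line $\mathbb C w$, with its reduced scheme structure. Let $\Gamma(P(W),\mathcal O(k))=S^k(W^*)$ be the space of homogeneous polynomials of degree $k$ on $W$, with $\mathcal A$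 acting by $(g f)(v)=f(g^{-1}v)$, and let $\Gamma(\mathcal N_w,\mathcal O(k))$ denote the quotient of $\Gamma(P(W),\mathcal O(k))$ by the subspace of the sections that vanish on $\mathcal N_w$; that is, the degree $k$ part of the homogeneous coordinate ring of $\mathcal N_w\subset P(W)$. Then: 1. $\operatorname{Proj} W^{[*]}\cong \mathcal N_w$ as schemes over $\mathbb C$. 2. Each $W^{[k]}$ is an $\mathcal A$-submodule of $W^{\otimes k}$, and there are isomorphisms of $\mathcal A$-modules $\Theta_k\colon W^{[k]}\xrightarrow{\ \sim\ }\Gamma(\mathcal N_w,\mathcal O(k))^*$ for all $k\ge 0$ that are compatible with multiplication: for all $i,j\ge 0$, $x\in W^{[i+j]}$, $\gamma_1\in\Gamma(\mathcal N_w,\mathcal O(i))$ and $\gamma_2\in\Gamma(\mathcal N_w,\mathcal O(j))$, $$\Theta_{i+j}(x)(\gamma_1\gamma_2)=\bigl((\Theta_i\otimes\Theta_j)(m_{i,j}(x))\bigr)(\gamma_1\otimes\gamma_2).$$ -/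

import Mathlib

open scoped TensorProduct DirectSum Manifold ContDiff
open CategoryTheory AlgebraicGeometry

noncomputable section

namespace HigherLevel

universe u

section Tensor

variable {W : Type u} [AddCommGroup W] [Module ℂ W]

/-- The derivation action of an operator `A` on `W^{⊗k}`:
`v₁ ⊗ ⋯ ⊗ v_k ↦ ∑ᵢ v₁ ⊗ ⋯ ⊗ A vᵢ ⊗ ⋯ ⊗ v_k`. -/
def tensorDer (k : ℕ) (A : Module.End ℂ W) : Module.End ℂ (⨂[ℂ]^k W) :=
  ∑ i : Fin k, PiTensorProduct.map (Function.update (fun _ => LinearMap.id) i A)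

/-- The diagonal action of an operator `B` on `W^{⊗k}`:
`v₁ ⊗ ⋯ ⊗ v_k ↦ B v₁ ⊗ ⋯ ⊗ B v_k`. -/
def tensorDiag (k : ℕ) (B : Module.End ℂ W) : Module.End ℂ (⨂[ℂ]^k W) :=
  PiTensorProduct.map fun _ => B

/-- The `ℂ`-subspace generated by `v` under a family of operators `T`: the smallest subspace that
contains `v` and is stable under all operators `T X`. When `T` is a representation of a Lie algebra
`𝔞`, this is the submodule `U(𝔞) v`; the module is cyclic with cyclic vector `v` when it is `⊤`. -/
def generated {ι V : Type*} [AddCommGroup V] [Module ℂ V] (T : ι → Module.End ℂ V) (v : V) :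
    Submodule ℂ V :=
  sInf {p | v ∈ p ∧ ∀ X, ∀ x ∈ p, T X x ∈ p}

variable {𝔞 : Type*} (φ : 𝔞 → Module.End ℂ W) (w : W)

/-- `w^{⊗k}`. -/
def tensorPow (k : ℕ) (w : W) : ⨂[ℂ]^k W := PiTensorProduct.tprod ℂ fun _ => w

/-- The higher level module `W^{[k]}`: the submodule of the `𝔞`-module `W^{⊗k}` generated by
`w^{⊗k}`, where `𝔞` acts on `W` through `φ`. -/
def level (k : ℕ) : Submodule ℂ (⨂[ℂ]^k W) :=
  generated (fun X => tensorDer k (φ X)) (tensorPow k w)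

variable {φ w} in
theorem level_le {k : ℕ} {p : Submodule ℂ (⨂[ℂ]^k W)} (hw : tensorPow k w ∈ p)
    (h : ∀ X, ∀ x ∈ p, tensorDer k (φ X) x ∈ p) : level φ w k ≤ p :=
  sInf_le ⟨hw, h⟩

theorem tensorPow_mem (k : ℕ) : tensorPow k w ∈ level φ w k :=
  Submodule.mem_sInf.2 fun _ hp => hp.1

theorem tensorDer_mem (k : ℕ) (X : 𝔞) {x : ⨂[ℂ]^k W} (hx : x ∈ level φ w k) :
    tensorDer k (φ X) x ∈ level φ w k :=
  Submodule.mem_sInf.2 fun p hp => hp.2 X x (Submodule.mem_sInf.1 hx p hp)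

theorem tensorDer_tprod (k : ℕ) (A : Module.End ℂ W) (v : Fin k → W) :
    tensorDer k A (PiTensorProduct.tprod ℂ v) =
      ∑ i, PiTensorProduct.tprod ℂ (Function.update v i (A (v i))) := by
  simp only [tensorDer, LinearMap.sum_apply, PiTensorProduct.map_tprod]
  refine Finset.sum_congr rfl fun i _ => ?_
  congr 1
  funext j
  by_cases h : j = i
  · subst h; simp
  · simp [h]

/-- Concatenation of tensors. -/
def cat (i j : ℕ) : (⨂[ℂ]^i W) ⊗[ℂ] (⨂[ℂ]^j W) ≃ₗ[ℂ] ⨂[ℂ]^(i + j) W :=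
  TensorPower.mulEquiv

theorem cat_tprod (i j : ℕ) (a : Fin i → W) (b : Fin j → W) :
    cat i j (PiTensorProduct.tprod ℂ a ⊗ₜ PiTensorProduct.tprod ℂ b) =
      PiTensorProduct.tprod ℂ (Fin.append a b) :=
  TensorPower.tprod_mul_tprod ℂ a b

theorem cat_symm_tprod (i j : ℕ) (v : Fin (i + j) → W) :
    (cat i j).symm (PiTensorProduct.tprod ℂ v) =
      PiTensorProduct.tprod ℂ (fun a => v (Fin.castAdd j a)) ⊗ₜ
        PiTensorProduct.tprod ℂ (fun b => v (Fin.natAdd i b)) := by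
  rw [LinearEquiv.symm_apply_eq, cat_tprod, Fin.append_castAdd_natAdd]

theorem cat_tensorPow (i j : ℕ) :
    cat i j (tensorPow i w ⊗ₜ tensorPow j w) = tensorPow (i + j) w := by
  rw [← LinearEquiv.eq_symm_apply, tensorPow, tensorPow, tensorPow, cat_symm_tprod]

theorem cat_der (i j : ℕ) (A : Module.End ℂ W) (t : (⨂[ℂ]^i W) ⊗[ℂ] (⨂[ℂ]^j W)) :
    tensorDer (i + j) A (cat i j t) =
      cat i j (TensorProduct.map (tensorDer i A) LinearMap.id t +
        TensorProduct.map LinearMap.id (tensorDer j A) t) := by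
  suffices h : tensorDer (i + j) A ∘ₗ (cat i j).toLinearMap =
      (cat i j).toLinearMap ∘ₗ (TensorProduct.map (tensorDer i A) LinearMap.id +
        TensorProduct.map LinearMap.id (tensorDer j A)) from LinearMap.congr_fun h t
  ext a b
  simp only [LinearMap.compMultilinearMap_apply, TensorProduct.AlgebraTensorModule.curry_apply,
    TensorProduct.curry_apply, LinearMap.coe_restrictScalars, LinearMap.comp_apply,
    LinearEquiv.coe_coe, LinearMap.add_apply, TensorProduct.map_tmul, LinearMap.id_apply,
    cat_tprod, tensorDer_tprod, TensorProduct.sum_tmul, TensorProduct.tmul_sum, map_add, map_sum,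
    Fin.sum_univ_add, Fin.append_left, Fin.append_right]
  congr 1
  · refine Finset.sum_congr rfl fun k _ => ?_
    congr 1
    funext l
    refine Fin.addCases (fun l => ?_) (fun l => ?_) l
    · by_cases h : l = k
      · subst h; simp
      · simp [h]
    · have : Fin.natAdd i l ≠ Fin.castAdd j k := by simp [Fin.ext_iff]; omega
      simp [this]
  · refine Finset.sum_congr rfl fun k _ => ?_
    congr 1
    funext l
    refine Fin.addCases (fun l => ?_) (fun l => ?_) l
    · have : Fin.castAdd j l ≠ Fin.natAdd i k := by simp [Fin.ext_iff]; omega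
      simp [this]
    · by_cases h : l = k
      · subst h; simp
      · simp [h]

/-- The map `W^{[i]} ⊗ W^{[j]} → W^{⊗(i+j)}` given by the inclusions. -/
def incl (i j : ℕ) : (level φ w i) ⊗[ℂ] (level φ w j) →ₗ[ℂ] ⨂[ℂ]^(i + j) W :=
  (cat i j).toLinearMap ∘ₗ TensorProduct.map (level φ w i).subtype (level φ w j).subtype

theorem incl_injective (i j : ℕ) : Function.Injective (incl φ w i j) := by
  refine (cat i j).injective.comp ?_
  exact TensorProduct.map_injective_of_flat_flat _ _ (level φ w i).injective_subtype
    (level φ w j).injective_subtype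

theorem level_le_range (i j : ℕ) : level φ w (i + j) ≤ LinearMap.range (incl φ w i j) := by
  refine level_le ?_ ?_
  · exact ⟨⟨_, tensorPow_mem φ w i⟩ ⊗ₜ ⟨_, tensorPow_mem φ w j⟩, by simp [incl, cat_tensorPow]⟩
  · rintro X _ ⟨t, rfl⟩
    induction t with
    | zero => simp
    | add x y hx hy => rw [map_add, map_add]; exact add_mem hx hy
    | tmul x y =>
      refine ⟨⟨_, tensorDer_mem φ w i X x.2⟩ ⊗ₜ y + x ⊗ₜ ⟨_, tensorDer_mem φ w j X y.2⟩, ?_⟩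
      simp [incl, cat_der]

/-- The inclusion `m_{i,j} : W^{[i+j]} ↪ W^{[i]} ⊗ W^{[j]}` of subspaces of `W^{⊗(i+j)}`. -/
def comul (i j : ℕ) : level φ w (i + j) →ₗ[ℂ] (level φ w i) ⊗[ℂ] (level φ w j) :=
  (LinearEquiv.ofInjective _ (incl_injective φ w i j)).symm.toLinearMap ∘ₗ
    Submodule.inclusion (level_le_range φ w i j)

theorem incl_comul (i j : ℕ) (x : level φ w (i + j)) :
    incl φ w i j (comul φ w i j x) = (x : ⨂[ℂ]^(i + j) W) := by
  have := LinearEquiv.apply_symm_apply (LinearEquiv.ofInjective _ (incl_injective φ w i j))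
    (Submodule.inclusion (level_le_range φ w i j) x)
  exact congrArg Subtype.val this

/-- The graded piece `(W^{[k]})^*`. -/
abbrev DualLevel (k : ℕ) : Type u := Module.Dual ℂ (level φ w k)

/-- The component `m_{i,j}^* : (W^{[i]})^* ⊗ (W^{[j]})^* → (W^{[i+j]})^*` of the multiplication. -/
def dualMul (i j : ℕ) : DualLevel φ w i →ₗ[ℂ] DualLevel φ w j →ₗ[ℂ] DualLevel φ w (i + j) :=
  (TensorProduct.mk ℂ _ _).compr₂
    ((comul φ w i j).dualMap ∘ₗ TensorProduct.dualDistrib ℂ (level φ w i) (level φ w j))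

theorem dualMul_apply (i j : ℕ) (f : DualLevel φ w i) (g : DualLevel φ w j)
    (x : level φ w (i + j)) :
    dualMul φ w i j f g x = TensorProduct.dualDistrib ℂ _ _ (f ⊗ₜ g) (comul φ w i j x) := rfl

/-- Auxiliary: the product of functionals on the full tensor powers. -/
def fullMul {i j : ℕ} (F : Module.Dual ℂ (⨂[ℂ]^i W)) (G : Module.Dual ℂ (⨂[ℂ]^j W)) :
    Module.Dual ℂ (⨂[ℂ]^(i + j) W) :=
  TensorProduct.dualDistrib ℂ _ _ (F ⊗ₜ G) ∘ₗ (cat i j).symm.toLinearMap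

theorem fullMul_tprod {i j : ℕ} (F : Module.Dual ℂ (⨂[ℂ]^i W)) (G : Module.Dual ℂ (⨂[ℂ]^j W))
    (v : Fin (i + j) → W) :
    fullMul F G (PiTensorProduct.tprod ℂ v) =
      F (PiTensorProduct.tprod ℂ fun a => v (Fin.castAdd j a)) *
        G (PiTensorProduct.tprod ℂ fun b => v (Fin.natAdd i b)) := by
  simp [fullMul, cat_symm_tprod]

theorem dualMul_restrict {i j : ℕ} (F : Module.Dual ℂ (⨂[ℂ]^i W))
    (G : Module.Dual ℂ (⨂[ℂ]^j W)) :
    dualMul φ w i j (F ∘ₗ (level φ w i).subtype) (G ∘ₗ (level φ w j).subtype) =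
      fullMul F G ∘ₗ (level φ w (i + j)).subtype := by
  ext x
  rw [dualMul_apply, LinearMap.comp_apply, Submodule.subtype_apply, ← incl_comul φ w i j x]
  generalize comul φ w i j x = t
  induction t with
  | zero => simp
  | add x y hx hy => rw [map_add, map_add, map_add, hx, hy]
  | tmul x y => simp [incl, fullMul]

theorem exists_full {k : ℕ} (f : DualLevel φ w k) :
    ∃ F : Module.Dual ℂ (⨂[ℂ]^k W), f = F ∘ₗ (level φ w k).subtype := by
  obtain ⟨F, hF⟩ := LinearMap.exists_extend f
  exact ⟨F, hF.symm⟩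

theorem mk_eq {i j : ℕ} (h : i = j) (F : Module.Dual ℂ (⨂[ℂ]^i W))
    (G : Module.Dual ℂ (⨂[ℂ]^j W))
    (H : ∀ x ∈ level φ w i, F x = G (TensorPower.cast ℂ W h x)) :
    GradedMonoid.mk (A := DualLevel φ w) i (F ∘ₗ (level φ w i).subtype) =
      GradedMonoid.mk j (G ∘ₗ (level φ w j).subtype) := by
  subst h
  congr 1
  ext x
  simpa using H x x.2

theorem mk_eq' {i j : ℕ} (h : i = j) (F : Module.Dual ℂ (⨂[ℂ]^i W))
    (G : Module.Dual ℂ (⨂[ℂ]^j W))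
    (H : ∀ v : Fin i → W, F (PiTensorProduct.tprod ℂ v) =
      G (PiTensorProduct.tprod ℂ (v ∘ Fin.cast h.symm))) :
    GradedMonoid.mk (A := DualLevel φ w) i (F ∘ₗ (level φ w i).subtype) =
      GradedMonoid.mk j (G ∘ₗ (level φ w j).subtype) := by
  refine mk_eq φ w h F G fun x _ => ?_
  suffices e : F = G ∘ₗ (TensorPower.cast ℂ W h).toLinearMap from LinearMap.congr_fun e x
  ext v
  simp [H, TensorPower.cast_tprod]

/-- The elements of `W^{[k]}` are symmetric tensors. -/
theorem reindex_of_mem {k : ℕ} (σ : Equiv.Perm (Fin k)) {x : ⨂[ℂ]^k W} (hx : x ∈ level φ w k) :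
    PiTensorProduct.reindex ℂ (fun _ => W) σ x = x := by
  let p : Submodule ℂ (⨂[ℂ]^k W) :=
    LinearMap.eqLocus (PiTensorProduct.reindex ℂ (fun _ => W) σ).toLinearMap LinearMap.id
  suffices h : level φ w k ≤ p from h hx
  refine level_le ?_ fun X x hx => ?_
  · change PiTensorProduct.reindex ℂ (fun _ => W) σ (tensorPow k w) = tensorPow k w
    rw [tensorPow, PiTensorProduct.reindex_tprod]
  · change PiTensorProduct.reindex ℂ (fun _ => W) σ (tensorDer k (φ X) x) = tensorDer k (φ X) x
    have hx' : PiTensorProduct.reindex ℂ (fun _ => W) σ x = x := hx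
    have key : (PiTensorProduct.reindex ℂ (fun _ => W) σ).toLinearMap ∘ₗ tensorDer k (φ X) =
        tensorDer k (φ X) ∘ₗ (PiTensorProduct.reindex ℂ (fun _ => W) σ).toLinearMap := by
      ext v
      simp only [LinearMap.compMultilinearMap_apply, LinearMap.comp_apply, LinearEquiv.coe_coe,
        tensorDer_tprod, map_sum, PiTensorProduct.reindex_tprod]
      refine Fintype.sum_equiv σ _ _ fun i => ?_
      congr 1
      funext l
      by_cases h : l = σ i
      · subst h
        simp only [Function.update_self]
        rw [Equiv.symm_apply_apply]
        simp
      · have : σ.symm l ≠ i := fun e => h (by simp [← e])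
        simp [h, this]
    have := LinearMap.congr_fun key x
    simp only [LinearMap.comp_apply, LinearEquiv.coe_coe] at this
    rw [this, hx']

/-- The unit: the element of `(W^{[0]})^* = ℂ^*` dual to the empty tensor. -/
def fullOne : Module.Dual ℂ (⨂[ℂ]^0 W) := (PiTensorProduct.isEmptyEquiv (Fin 0)).toLinearMap

theorem fullOne_tprod (v : Fin 0 → W) : fullOne (PiTensorProduct.tprod ℂ v) = 1 := by
  simp [fullOne]

/-- The unit of `W^{[*]}`, an element of `(W^{[0]})^*`. -/
def dualOne : DualLevel φ w 0 := fullOne ∘ₗ (level φ w 0).subtype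

instance : GradedMonoid.GMul (DualLevel φ w) where
  mul {i j} f g := dualMul φ w i j f g

instance : GradedMonoid.GOne (DualLevel φ w) where
  one := dualOne φ w

theorem mk_mul_mk {i j : ℕ} (F : Module.Dual ℂ (⨂[ℂ]^i W)) (G : Module.Dual ℂ (⨂[ℂ]^j W)) :
    GradedMonoid.mk (A := DualLevel φ w) i (F ∘ₗ (level φ w i).subtype) *
      GradedMonoid.mk (A := DualLevel φ w) j (G ∘ₗ (level φ w j).subtype) =
    GradedMonoid.mk (A := DualLevel φ w) (i + j) (fullMul F G ∘ₗ (level φ w (i + j)).subtype) :=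
  congrArg (GradedMonoid.mk (A := DualLevel φ w) (i + j)) (dualMul_restrict φ w F G)

theorem gm_one_mul (a : GradedMonoid (DualLevel φ w)) : 1 * a = a := by
  obtain ⟨i, f⟩ := a
  obtain ⟨F, rfl⟩ := exists_full φ w f
  refine (mk_mul_mk φ w fullOne F).trans (mk_eq' φ w (zero_add i) _ _ fun v => ?_)
  rw [fullMul_tprod, fullOne_tprod, one_mul]
  congr 2
  funext l
  congr 1
  ext
  simp

theorem gm_mul_one (a : GradedMonoid (DualLevel φ w)) : a * 1 = a := by
  obtain ⟨i, f⟩ := a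
  obtain ⟨F, rfl⟩ := exists_full φ w f
  refine (mk_mul_mk φ w F fullOne).trans (mk_eq' φ w (add_zero i) _ _ fun v => ?_)
  rw [fullMul_tprod, fullOne_tprod, mul_one]
  rfl

theorem gm_mul_assoc (a b c : GradedMonoid (DualLevel φ w)) : a * b * c = a * (b * c) := by
  obtain ⟨i, f⟩ := a
  obtain ⟨F, rfl⟩ := exists_full φ w f
  obtain ⟨j, g⟩ := b
  obtain ⟨G, rfl⟩ := exists_full φ w g
  obtain ⟨k, h⟩ := c
  obtain ⟨H, rfl⟩ := exists_full φ w h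
  have e1 := mk_mul_mk φ w F G
  have e2 := mk_mul_mk φ w G H
  have e3 := mk_mul_mk φ w (fullMul F G) H
  have e4 := mk_mul_mk φ w F (fullMul G H)
  refine ((congrArg (· * _) e1).trans e3).trans (Eq.trans ?_
    ((congrArg (_ * ·) e2).trans e4).symm)
  refine mk_eq' φ w (add_assoc i j k) _ _ fun v => ?_
  simp only [fullMul_tprod, mul_assoc]
  congr 3
  · congr 1
    funext l
    simp only [Function.comp]
    congr 1
    ext
    simp [add_assoc]

theorem gm_mul_comm (a b : GradedMonoid (DualLevel φ w)) : a * b = b * a := by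
  obtain ⟨i, f⟩ := a
  obtain ⟨F, rfl⟩ := exists_full φ w f
  obtain ⟨j, g⟩ := b
  obtain ⟨G, rfl⟩ := exists_full φ w g
  refine (mk_mul_mk φ w F G).trans (Eq.trans ?_ (mk_mul_mk φ w G F).symm)
  refine mk_eq φ w (add_comm i j) _ _ fun x hx => ?_
  let σ : Equiv.Perm (Fin (i + j)) := finAddFlip.trans (finCongr (add_comm j i))
  suffices e : fullMul F G = fullMul G F ∘ₗ (TensorPower.cast ℂ W (add_comm i j)).toLinearMap ∘ₗ
      (PiTensorProduct.reindex ℂ (fun _ => W) σ).toLinearMap by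
    rw [e]
    simp [reindex_of_mem φ w σ hx]
  ext v
  simp only [LinearMap.compMultilinearMap_apply, LinearMap.comp_apply, LinearEquiv.coe_coe,
    PiTensorProduct.reindex_tprod, TensorPower.cast_tprod, fullMul_tprod]
  rw [mul_comm]
  congr 3
  · funext l
    have e : σ.symm (Fin.cast (add_comm j i) (Fin.castAdd i l)) = Fin.natAdd i l := by
      rw [Equiv.symm_apply_eq]
      simp [σ]
    exact congrArg v e.symm
  · funext l
    have e : σ.symm (Fin.cast (add_comm j i) (Fin.natAdd j l)) = Fin.castAdd j l := by
      rw [Equiv.symm_apply_eq]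
      simp [σ]
    exact congrArg v e.symm

instance : DirectSum.GCommRing (DualLevel φ w) where
  mul {i j} f g := dualMul φ w i j f g
  one := dualOne φ w
  mul_zero f := map_zero _
  zero_mul g := LinearMap.map_zero₂ _ _
  mul_add f g h := map_add _ _ _
  add_mul f g h := LinearMap.map_add₂ _ _ _ _
  one_mul := gm_one_mul φ w
  mul_one := gm_mul_one φ w
  mul_assoc := gm_mul_assoc φ w
  mul_comm := gm_mul_comm φ w
  natCast n := n • dualOne φ w
  natCast_zero := zero_smul _ _
  natCast_succ n := succ_nsmul _ _
  intCast n := n • dualOne φ w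
  intCast_ofNat n := natCast_zsmul _ _
  intCast_negSucc_ofNat n := negSucc_zsmul _ _

theorem mk_smul_one (r : ℂ) (a : GradedMonoid (DualLevel φ w)) :
    GradedMonoid.mk (A := DualLevel φ w) 0 (r • dualOne φ w) * a =
      GradedMonoid.mk a.1 (r • a.2) := by
  obtain ⟨i, f⟩ := a
  obtain ⟨F, rfl⟩ := exists_full φ w f
  refine (mk_mul_mk φ w (r • fullOne) F).trans (mk_eq' φ w (zero_add i) _ (r • F) fun v => ?_)
  rw [fullMul_tprod, LinearMap.smul_apply, LinearMap.smul_apply, fullOne_tprod, smul_eq_mul,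
    smul_eq_mul, mul_one]
  congr 3
  funext l
  congr 1
  ext
  simp

instance : DirectSum.GAlgebra ℂ (DualLevel φ w) where
  toFun := (LinearMap.toSpanSingleton ℂ (DualLevel φ w 0) (dualOne φ w)).toAddMonoidHom
  map_one := one_smul ℂ (dualOne φ w)
  map_mul r s := by
    refine Eq.trans ?_ (mk_smul_one φ w r (GradedMonoid.mk 0 (s • dualOne φ w))).symm
    exact congrArg (GradedMonoid.mk (A := DualLevel φ w) 0) (mul_smul r s (dualOne φ w))
  commutes r x := gm_mul_comm φ w _ _
  smul_def r x := (mk_smul_one φ w r x).symm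

/-- The commutative algebra `W^{[*]} = ⨁ₖ (W^{[k]})^*`, with multiplication `⨁ m_{i,j}^*`. -/
abbrev LevelAlgebra : Type u := ⨁ k, DualLevel φ w k

/-- The component of degree `k` of `W^{[*]}`. -/
def levelGrading (k : ℕ) : Submodule ℂ (LevelAlgebra φ w) :=
  LinearMap.range (DirectSum.lof ℂ ℕ (DualLevel φ w) k)

theorem lof_mem (k : ℕ) (f : DualLevel φ w k) :
    DirectSum.lof ℂ ℕ (DualLevel φ w) k f ∈ levelGrading φ w k := ⟨f, rfl⟩

instance : SetLike.GradedMonoid (levelGrading φ w) where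
  one_mem := ⟨dualOne φ w, rfl⟩
  mul_mem := by
    rintro i j _ _ ⟨f, rfl⟩ ⟨g, rfl⟩
    exact ⟨dualMul φ w i j f g, (DirectSum.of_mul_of (A := DualLevel φ w) f g).symm⟩

instance : GradedAlgebra (levelGrading φ w) where
  toDecomposition := DirectSum.Decomposition.ofLinearMap (levelGrading φ w)
    (DirectSum.toModule ℂ ℕ _ fun k =>
      DirectSum.lof ℂ ℕ (fun k => levelGrading φ w k) k ∘ₗ
        (DirectSum.lof ℂ ℕ (DualLevel φ w) k).codRestrict _ (lof_mem φ w k))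
    (by
      ext k f : 2
      simp)
    (by
      ext k ⟨_, f, rfl⟩ : 2
      simp
      rfl)
end Tensor
section Geometry

variable (W : Type u) [AddCommGroup W] [Module ℂ W]

/-- The algebra `S^*(W^*)` of polynomial functions on `W`. -/
abbrev Poly : Type u := SymmetricAlgebra ℂ (Module.Dual ℂ W)

/-- Homogeneous polynomials of degree `k` on `W`: the space `Γ(P(W), O(k)) = S^k(W^*)`. -/
def homogPoly (k : ℕ) : Submodule ℂ (Poly W) :=
  (LinearMap.range (SymmetricAlgebra.ι ℂ (Module.Dual ℂ W))) ^ k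

instance : SetLike.GradedMonoid (homogPoly W) :=
  Submodule.nat_power_gradedMonoid (LinearMap.range (SymmetricAlgebra.ι ℂ (Module.Dual ℂ W)))

theorem ι_mem (ξ : Module.Dual ℂ W) :
    SymmetricAlgebra.ι ℂ (Module.Dual ℂ W) ξ ∈ homogPoly W 1 := by
  simpa only [homogPoly, pow_one] using LinearMap.mem_range_self _ ξ

/-- Auxiliary: the splitting of a polynomial into its homogeneous components. -/
def polySplit : Poly W →ₐ[ℂ] ⨁ k, homogPoly W k :=
  SymmetricAlgebra.lift (DirectSum.lof ℂ ℕ (fun k => homogPoly W k) 1 ∘ₗ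
    (SymmetricAlgebra.ι ℂ (Module.Dual ℂ W)).codRestrict _ (ι_mem W))

theorem polySplit_ι (ξ : Module.Dual ℂ W) :
    polySplit W (SymmetricAlgebra.ι ℂ (Module.Dual ℂ W) ξ) =
      DirectSum.of (fun k => homogPoly W k) 1 ⟨_, ι_mem W ξ⟩ := by
  rw [polySplit, SymmetricAlgebra.lift_ι_apply]
  rfl

theorem polySplit_eq (k : ℕ) (x : homogPoly W k) :
    polySplit W x = DirectSum.of (fun k => homogPoly W k) k x := by
  obtain ⟨x, hx⟩ := x
  dsimp only
  induction hx using Submodule.pow_induction_on_left' with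
  | algebraMap r => rw [AlgHom.commutes, DirectSum.algebraMap_apply]; rfl
  | add x y i hx hy ihx ihy => rw [map_add, ihx, ihy, ← map_add]; rfl
  | mem_mul m hm i x hx ih =>
      obtain ⟨ξ, rfl⟩ := hm
      rw [map_mul, ih, polySplit_ι, DirectSum.of_mul_of]
      exact DirectSum.of_eq_of_gradedMonoid_eq (Sigma.subtype_ext (add_comm _ _) rfl)

instance : GradedAlgebra (homogPoly W) :=
  GradedAlgebra.ofAlgHom _ (polySplit W)
    (by
      ext ξ
      simp [polySplit_ι])
    (polySplit_eq W)

variable {W}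

/-- Evaluation of polynomials at a vector of `W`. -/
def evalAt (v : W) : Poly W →ₐ[ℂ] ℂ := SymmetricAlgebra.lift (Module.Dual.eval ℂ W v)

/-- The point `ℂ v` of `P(W) = Proj S^*(W^*)`: the homogeneous prime ideal generated by the
homogeneous polynomials that vanish at `v ≠ 0`. -/
def linePoint (v : W) (hv : v ≠ 0) : ProjectiveSpectrum (homogPoly W) where
  asHomogeneousIdeal := (RingHom.ker (evalAt v)).homogeneousCore (homogPoly W)
  isPrime := Ideal.IsPrime.homogeneousCore (RingHom.ker_isPrime (evalAt v).toRingHom)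
  not_irrelevant_le h := by
    obtain ⟨ξ, hξ⟩ : ∃ ξ : Module.Dual ℂ W, ξ v ≠ 0 := by
      by_contra! H
      exact hv ((Module.forall_dual_apply_eq_zero_iff ℂ v).1 H)
    refine hξ ?_
    have h1 : SymmetricAlgebra.ι ℂ (Module.Dual ℂ W) ξ ∈
        HomogeneousIdeal.irrelevant (homogPoly W) := by
      rw [HomogeneousIdeal.mem_irrelevant_iff, GradedRing.proj_apply,
        DirectSum.decompose_of_mem_ne _ (ι_mem W ξ) one_ne_zero]
    have h2 := Ideal.toIdeal_homogeneousCore_le _ _ (h h1)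
    simpa [evalAt, RingHom.mem_ker] using h2

theorem mem_linePoint {v : W} {hv : v ≠ 0} {k : ℕ} {f : Poly W} (hf : f ∈ homogPoly W k) :
    f ∈ (linePoint v hv).asHomogeneousIdeal ↔ evalAt v f = 0 :=
  ⟨fun h => Ideal.toIdeal_homogeneousCore_le _ _ h,
    fun h => Ideal.mem_homogeneousCore_of_homogeneous_of_mem ⟨k, hf⟩ h⟩

/-- The structure morphism to `Spec ℂ` of the projective spectrum of a graded `ℂ`-algebra
(`ULift ℂ` is `ℂ` placed in the universe of the algebra). -/
def projToBase {A : Type u} [CommRing A] [Algebra ℂ A] (𝒜 : ℕ → Submodule ℂ A)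
    [GradedAlgebra 𝒜] : Proj 𝒜 ⟶ Spec (CommRingCat.of (ULift.{u} ℂ)) :=
  Proj.toSpecZero 𝒜 ≫ Spec.map 
    (CommRingCat.ofHom ((algebraMap ℂ (𝒜 0)).comp (ULift.ringEquiv (R := ℂ)).toRingHom))

variable {G : Type*} [Group G] (ρ : Representation ℂ G W) (w : W)

/-- The `G`-orbit of the line `ℂ w` in `P(W)`. -/
def orbit : Set (Proj (homogPoly W)) :=
  {x | ∃ (g : G) (h : ρ g w ≠ 0), x = linePoint (ρ g w) h}

/-- The closure of the orbit of the line `ℂ w` in the Zariski topology of `P(W)`. -/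
def orbitClosure : TopologicalSpace.Closeds (Proj (homogPoly W)) :=
  TopologicalSpace.Closeds.closure (orbit ρ w)

/-- The variety `N_w`: the closure of the orbit with its reduced scheme structure. -/
def orbitVariety : Scheme.{u} :=
  (Scheme.IdealSheafData.vanishingIdeal (orbitClosure ρ w)).subscheme

/-- The embedding of `N_w` in `P(W)`. -/
def orbitVarietyι : orbitVariety ρ w ⟶ Proj (homogPoly W) :=
  (Scheme.IdealSheafData.vanishingIdeal (orbitClosure ρ w)).subschemeι

/-- The homogeneous polynomials of degree `k` that vanish at all points of `N_w`. -/
def vanishing (k : ℕ) : Submodule ℂ (homogPoly W k) where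
  carrier := {f | ∀ x ∈ orbitClosure ρ w, (f : Poly W) ∈ x.asHomogeneousIdeal}
  zero_mem' _ _ := zero_mem _
  add_mem' hf hg x hx := add_mem (hf x hx) (hg x hx)
  smul_mem' c f hf x hx := by
    rw [Submodule.coe_smul, Algebra.smul_def]
    exact Ideal.mul_mem_left _ _ (hf x hx)

theorem mem_vanishing_iff {k : ℕ} (f : homogPoly W k) :
    f ∈ vanishing ρ w k ↔ ∀ g : G, ρ g w ≠ 0 → evalAt (ρ g w) (f : Poly W) = 0 := by
  constructor
  · intro h g hg
    exact (mem_linePoint f.2).1 (h (linePoint (ρ g w) hg) (subset_closure ⟨g, hg, rfl⟩))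
  · intro h
    have hc : IsClosed (ProjectiveSpectrum.zeroLocus (homogPoly W) {(f : Poly W)}) :=
      ProjectiveSpectrum.isClosed_zeroLocus _ _
    have hs : orbit ρ w ⊆ ProjectiveSpectrum.zeroLocus (homogPoly W) {(f : Poly W)} := by
      rintro _ ⟨g, hg, rfl⟩
      exact Set.singleton_subset_iff.2 ((mem_linePoint f.2).2 (h g hg))
    intro x hx
    exact Set.singleton_subset_iff.1 (closure_minimal hs hc hx)

/-- The space `Γ(N_w, O(k))`: the quotient of `Γ(P(W), O(k)) = S^k(W^*)` by the subspace of sections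
that vanish on `N_w`, i.e. the sections of `O(k)` on `N_w` cut out by homogeneous polynomials. -/
abbrev Sections (k : ℕ) : Type u := homogPoly W k ⧸ vanishing ρ w k

/-- The action of `g` on polynomials, `(g f)(v) = f(g⁻¹ v)`. -/
def polyAct (g : G) : Poly W →ₐ[ℂ] Poly W :=
  SymmetricAlgebra.lift (SymmetricAlgebra.ι ℂ (Module.Dual ℂ W) ∘ₗ ρ.dual g)

theorem polyAct_ι (g : G) (ξ : Module.Dual ℂ W) :
    polyAct ρ g (SymmetricAlgebra.ι ℂ (Module.Dual ℂ W) ξ) =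
      SymmetricAlgebra.ι ℂ (Module.Dual ℂ W) (ρ.dual g ξ) :=
  SymmetricAlgebra.lift_ι_apply _ ξ

theorem evalAt_polyAct (g : G) (v : W) (f : Poly W) :
    evalAt v (polyAct ρ g f) = evalAt (ρ g⁻¹ v) f := by
  suffices h : (evalAt v).comp (polyAct ρ g) = evalAt (ρ g⁻¹ v) from AlgHom.congr_fun h f
  ext ξ
  simp [evalAt, polyAct, Representation.dual_apply, Module.Dual.transpose_apply]

theorem polyAct_mem (g : G) {k : ℕ} {f : Poly W} (hf : f ∈ homogPoly W k) :
    polyAct ρ g f ∈ homogPoly W k := by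
  have h : (homogPoly W k).map (polyAct ρ g).toLinearMap ≤ homogPoly W k := by
    rw [homogPoly, Submodule.map_pow]
    refine pow_le_pow_left' ?_ k
    rintro _ ⟨_, ⟨ξ, rfl⟩, rfl⟩
    exact ⟨ρ.dual g ξ, by simp [polyAct]⟩
  exact h ⟨f, hf, rfl⟩

/-- The action of `G` on homogeneous polynomials of degree `k`. -/
def homogPolyRep (k : ℕ) : Representation ℂ G (homogPoly W k) where
  toFun g := (polyAct ρ g).toLinearMap.restrict fun _ hf => polyAct_mem ρ g hf
  map_one' := by
    have h : polyAct ρ 1 = AlgHom.id ℂ (Poly W) := by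
      ext ξ
      change polyAct ρ 1 (SymmetricAlgebra.ι ℂ _ ξ) = SymmetricAlgebra.ι ℂ _ ξ
      rw [polyAct_ι, map_one, Module.End.one_apply]
    ext f
    exact AlgHom.congr_fun h (f : Poly W)
  map_mul' a b := by
    have h : polyAct ρ (a * b) = (polyAct ρ a).comp (polyAct ρ b) := by
      ext ξ
      change polyAct ρ (a * b) (SymmetricAlgebra.ι ℂ _ ξ) =
        polyAct ρ a (polyAct ρ b (SymmetricAlgebra.ι ℂ _ ξ))
      rw [polyAct_ι, polyAct_ι, polyAct_ι, map_mul, Module.End.mul_apply]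
    ext f
    exact AlgHom.congr_fun h (f : Poly W)

theorem homogPolyRep_vanishing (k : ℕ) (g : G) :
    vanishing ρ w k ≤ (vanishing ρ w k).comap (homogPolyRep ρ k g) := by
  intro f hf
  rw [Submodule.mem_comap, mem_vanishing_iff]
  rw [mem_vanishing_iff] at hf
  intro h hh
  have e : ρ g⁻¹ (ρ h w) = ρ (g⁻¹ * h) w := by rw [map_mul]; rfl
  refine (evalAt_polyAct ρ g (ρ h w) f).trans ?_
  rw [e]
  refine hf (g⁻¹ * h) fun h0 => hh ?_
  have : ρ h w = ρ g (ρ (g⁻¹ * h) w) := by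
    rw [← Module.End.mul_apply, ← map_mul, mul_inv_cancel_left]
  rw [this, h0, map_zero]

/-- The action of `G` on `Γ(N_w, O(k))`. -/
def sectionsRep (k : ℕ) : Representation ℂ G (Sections ρ w k) where
  toFun g := Submodule.mapQ _ _ (homogPolyRep ρ k g) (homogPolyRep_vanishing ρ w k g)
  map_one' := by
    refine Submodule.linearMap_qext _ ?_
    ext f
    simp
  map_mul' a b := by
    refine Submodule.linearMap_qext _ ?_
    ext f
    simp

/-- Multiplication of homogeneous polynomials. -/
def homogMul (i j : ℕ) : homogPoly W i →ₗ[ℂ] homogPoly W j →ₗ[ℂ] homogPoly W (i + j) :=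
  LinearMap.mk₂ ℂ (fun f g => ⟨(f : Poly W) * g, SetLike.mul_mem_graded f.2 g.2⟩)
    (fun _ _ _ => Subtype.ext (add_mul _ _ _)) (fun _ _ _ => Subtype.ext (smul_mul_assoc _ _ _))
    (fun _ _ _ => Subtype.ext (mul_add _ _ _)) (fun _ _ _ => Subtype.ext (mul_smul_comm _ _ _))

/-- Multiplication of sections `Γ(N_w, O(i)) × Γ(N_w, O(j)) → Γ(N_w, O(i+j))`. -/
def sectionsMul (i j : ℕ) :
    Sections ρ w i →ₗ[ℂ] Sections ρ w j →ₗ[ℂ] Sections ρ w (i + j) :=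
  Submodule.liftQ _
    (LinearMap.flip (Submodule.liftQ _
      (LinearMap.flip ((homogMul i j).compr₂ (vanishing ρ w (i + j)).mkQ)) (by
        intro g hg
        ext f
        exact (Submodule.Quotient.mk_eq_zero _).2 fun x hx =>
          Ideal.mul_mem_left _ (f : Poly W) (hg x hx)))) (by
    intro f hf
    refine Submodule.linearMap_qext _ ?_
    ext g
    exact (Submodule.Quotient.mk_eq_zero _).2 fun x hx =>
      Ideal.mul_mem_right (g : Poly W) _ (hf x hx))

theorem sectionsMul_mk (i j : ℕ) (f : homogPoly W i) (g : homogPoly W j) :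
    sectionsMul ρ w i j (Submodule.Quotient.mk f) (Submodule.Quotient.mk g) =
      Submodule.Quotient.mk (homogMul i j f g) := rfl

end Geometry

end HigherLevel

end

open HigherLevel

/-!
Write `𝔞` for the Lie algebra. The heart of the matter is that `W^{[k]}` is the linear span of the
tensors `(g w)^{⊗k}`, `g ∈ G` (`level_eq_span`). The span is stable under `𝔞`, because the
derivation action is the derivative of the diagonal action along curves through `1`, and a subspace
of a finite-dimensional space contains the derivatives of its curves. Conversely, every `𝔞`-stable
subspace `p` of `W^{⊗k}` is `G`-stable (`tensorDiag_mem_of_tensorDer_mem`): along a curve `γ` in a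
chart at `1` the operators `R = ρ(γ)^{⊗k}` solve `R' = R A` with `A` in the image of `𝔞`, so a
functional that kills `p` satisfies a linear differential equation with initial value zero when
composed with `R`, restricted to `p` (`mem_of_hasDerivAt_comp`); this settles a neighbourhood of
`1`, which generates the connected group `G`.

A homogeneous polynomial `P` of degree `k` on `W` restricts to a functional on `W^{[k]} ⊆ W^{⊗k}`
whose value at `(g w)^{⊗k}` is `P(g w)`. These restrictions form a surjective homomorphism
`S^*(W^*) → W^{[*]}` of graded algebras (`toLevel`). As the tensors `(g w)^{⊗k}` span, its kernel in
degree `k` consists of the polynomials that vanish on the orbit, that is on `N_w`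
(`ker_toDualLevel`). Thus `Γ(N_w, O(k)) ≅ (W^{[k]})^*`, compatibly with products and with the
action of `G`, and `Θ_k` is the dual of this isomorphism (`levelEquiv`).

The surjection induces a closed immersion `Proj W^{[*]} → P(W)` (`isClosedImmersion_projMap`) with
image the zero locus of the kernel, which is the orbit closure (`ker_le_iff`). Since `W^{[*]}` is
reduced (`isReduced_levelAlgebra`), so is its projective spectrum; hence it is the orbit closure
with the reduced structure (`exists_proj_iso`).
-/

namespace HigherLevel

section Analysis

open Set Filter Topology

/-! ### Linear differential equations and multilinear maps -/

/-- A linear system of ordinary differential equations with continuous coefficients and zero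
initial value has only the zero solution. -/
theorem eq_zero_of_hasDerivAt_linear {ι : Type*} [Fintype ι] {a : ℝ → ι → ι → ℂ} {u : ℝ → ι → ℂ}
    (ha : ∀ i j, ContinuousOn (fun t => a t i j) (Icc 0 1))
    (hu : ∀ t ∈ Icc (0 : ℝ) 1, ∀ i, HasDerivAt (fun s => u s i) (∑ j, a t i j * u t j) t)
    (h0 : u 0 = 0) {t : ℝ} (ht : t ∈ Icc (0 : ℝ) 1) : u t = 0 := by
  have hb : ∃ C, ∀ i j, ∀ t ∈ Icc (0 : ℝ) 1, ‖a t i j‖ ≤ C := by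
    choose C hC using fun i j => isCompact_Icc.exists_bound_of_continuousOn (ha i j)
    refine ⟨∑ i, ∑ j, |C i j|, fun i j t ht => ((hC i j t ht).trans (le_abs_self _)).trans ?_⟩
    refine le_trans ?_ (Finset.single_le_sum (f := fun i => ∑ j, |C i j|)
      (fun i _ => Finset.sum_nonneg fun j _ => abs_nonneg _) (Finset.mem_univ i))
    exact Finset.single_le_sum (f := fun j => |C i j|) (fun j _ => abs_nonneg _)
      (Finset.mem_univ j)
  obtain ⟨C, hC⟩ := hb
  have hd : ∀ t ∈ Icc (0 : ℝ) 1, HasDerivAt u (fun i => ∑ j, a t i j * u t j) t := fun t ht =>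
    hasDerivAt_pi.2 (hu t ht)
  refine eq_zero_of_abs_deriv_le_mul_abs_self_of_eq_zero_right (K := Fintype.card ι * |C|)
    (fun t ht => (hd t ht).continuousAt.continuousWithinAt)
    (fun t ht => (hd t (Ico_subset_Icc_self ht)).hasDerivWithinAt) h0 (fun t ht => ?_) t ht
  refine (pi_norm_le_iff_of_nonneg (by positivity)).2 fun i => ?_
  refine (norm_sum_le _ _).trans ?_
  rw [mul_assoc, ← nsmul_eq_mul]
  refine Finset.sum_le_card_nsmul _ _ _ fun j _ => ?_
  rw [norm_mul]
  exact mul_le_mul ((hC i j t (Ico_subset_Icc_self ht)).trans (le_abs_self _)) (norm_le_pi_norm _ j)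
    (norm_nonneg _) (abs_nonneg _)

/-- If a curve of operators `R` solves `R' = R ∘ A` and all `A t` preserve a subspace `p`, then so
does `R t`, provided that `R 0` does. Derivatives are taken after applying linear functionals, so
that no norm on `V` is needed. -/
theorem mem_of_hasDerivAt_comp {V : Type*} [AddCommGroup V] [Module ℂ V]
    [FiniteDimensional ℂ V] (p : Submodule ℂ V) {R A : ℝ → V →ₗ[ℂ] V}
    (hA : ∀ t ∈ Icc (0 : ℝ) 1, ∀ x ∈ p, A t x ∈ p) (h0 : ∀ x ∈ p, R 0 x ∈ p)
    (hc : ∀ (l : Module.Dual ℂ V) (x : V), ContinuousOn (fun t => l (A t x)) (Icc 0 1))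
    (hd : ∀ (l : Module.Dual ℂ V) (x : V), ∀ t ∈ Icc (0 : ℝ) 1,
      HasDerivAt (fun s => l (R s x)) (l (R t (A t x))) t)
    {t : ℝ} (ht : t ∈ Icc (0 : ℝ) 1) {x : V} (hx : x ∈ p) : R t x ∈ p := by
  classical
  let b := Module.finBasis ℂ p
  suffices h : ∀ i, R t (b i) ∈ p by
    have hx' : ((∑ i, b.repr ⟨x, hx⟩ i • b i : p) : V) = x :=
      congrArg Subtype.val (b.sum_repr ⟨x, hx⟩)
    rw [← hx', AddSubmonoidClass.coe_finsetSum, map_sum]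
    simp only [Submodule.coe_smul, map_smul]
    exact Submodule.sum_mem _ fun i _ => p.smul_mem _ (h i)
  intro i
  by_contra hi
  obtain ⟨l, hl, hlp⟩ := Submodule.exists_le_ker_of_notMem hi
  have hlp : ∀ y ∈ p, l y = 0 := fun y hy => by simpa using hlp hy
  -- the coordinates on `p` extend to functionals on `V`
  choose c hcoord using fun j => LinearMap.exists_extend (b.coord j)
  -- the functions `t ↦ l (R t (b i))` solve a linear system, whose matrix is that of `A t` on `p`
  have key := eq_zero_of_hasDerivAt_linear (a := fun t i j => c j (A t (b i)))
    (u := fun t i => l (R t (b i))) (fun i j => hc _ _) (fun t ht i => ?_) ?_ ht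
  · exact hl (congrFun key i)
  · convert hd l (b i) t ht using 1
    have e : A t (b i) = ∑ j, c j (A t (b i)) • (b j : V) := by
      have := congrArg Subtype.val (b.sum_repr ⟨A t (b i), hA t ht _ (b i).2⟩)
      simp only [AddSubmonoidClass.coe_finsetSum, Submodule.coe_smul] at this
      rw [← this]
      refine Finset.sum_congr rfl fun j _ => ?_
      rw [this]
      congr 1
      exact (LinearMap.congr_fun (hcoord j) ⟨A t (b i), hA t ht _ (b i).2⟩).symm
    conv_rhs => rw [e]
    simp
  · funext i
    exact hlp _ (h0 _ (b i).2)

/-- Multilinear maps on finite-dimensional spaces are continuous. -/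
theorem continuous_multilinearMap {k : ℕ} {W : Type*} [NormedAddCommGroup W] [NormedSpace ℂ W]
    [FiniteDimensional ℂ W] (m : MultilinearMap ℂ (fun _ : Fin k => W) ℂ) : Continuous m := by
  classical
  let b := Module.finBasis ℂ W
  have e : ⇑m = fun v => ∑ r : Fin k → Fin (Module.finrank ℂ W),
      (∏ i, b.repr (v i) (r i)) • m fun i => b (r i) := by
    funext v
    conv_lhs => rw [show v = fun i => ∑ j, b.repr (v i) j • b j from
      funext fun i => (b.sum_repr (v i)).symm]
    rw [m.map_sum]
    exact Finset.sum_congr rfl fun r _ => m.map_smul_univ _ _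
  rw [e]
  refine continuous_finsetSum _ fun r _ => Continuous.mul_const ?_ _
  refine continuous_finsetProd _ fun i _ => ?_
  exact (LinearMap.continuous_of_finiteDimensional (b.coord (r i))).comp (continuous_apply i)

/-- The Leibniz rule for multilinear maps along curves. -/
theorem hasDerivAt_multilinearMap {k : ℕ} {W : Type*} [NormedAddCommGroup W] [NormedSpace ℂ W]
    [FiniteDimensional ℂ W] (m : MultilinearMap ℂ (fun _ : Fin k => W) ℂ)
    {g : Fin k → ℝ → W} {g' : Fin k → W} {t : ℝ} (hg : ∀ i, HasDerivAt (g i) (g' i) t) :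
    HasDerivAt (fun s => m fun i => g i s)
      (∑ i, m (Function.update (fun j => g j t) i (g' i))) t := by
  let M : ContinuousMultilinearMap ℝ (fun _ : Fin k => W) ℂ :=
    { m.restrictScalars ℝ with cont := continuous_multilinearMap m }
  have := (HasFDerivAt.multilinear_comp M fun i => (hg i).hasFDerivAt).hasDerivAt
  refine this.congr_deriv ?_
  rw [sum_apply]
  refine Finset.sum_congr rfl fun i _ => ?_
  simp only [ContinuousLinearMap.comp_apply, ContinuousLinearMap.toSpanSingleton_apply, one_smul]
  rfl

/-! ### Curves in a Lie group near the identity -/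

section LieGroup

variable {𝕜 : Type*} [RCLike 𝕜]
  {E : Type*} [NormedAddCommGroup E] [NormedSpace 𝕜 E]
  {G : Type*} [TopologicalSpace G] [ChartedSpace E G] [Group G]
  {W : Type*} [NormedAddCommGroup W] [NormedSpace ℂ W]
  [NormedSpace 𝕜 W]

/-- Continuous field homomorphisms `𝕜 → ℂ` are `ℝ`-linear, whence the real structures which `W`
gets from `𝕜` and from `ℂ` agree. -/
theorem isScalarTower_real (𝕜 W : Type*) [RCLike 𝕜] [NormedAlgebra 𝕜 ℂ] [NormedAddCommGroup W]
    [NormedSpace ℂ W] [NormedSpace 𝕜 W] [IsScalarTower 𝕜 ℂ W] : IsScalarTower ℝ 𝕜 W where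
  smul_assoc r a x := by
    have h : algebraMap 𝕜 ℂ (r • a) = r • algebraMap 𝕜 ℂ a :=
      map_real_smul (algebraMap 𝕜 ℂ) (continuous_algebraMap 𝕜 ℂ) r a
    rw [← algebraMap_smul ℂ (r • a) x, h, ← algebraMap_smul ℂ a x, smul_assoc]

variable (𝕜 E G) in
/-- The inverse of the preferred chart of `G` at the identity. -/
noncomputable def oneChartSymm : E → G := (extChartAt 𝓘(𝕜, E) (1 : G)).symm

variable [LieGroup 𝓘(𝕜, E) ∞ G] {ρ : Representation ℂ G W}
  (hρ : ∀ v, ContMDiff 𝓘(𝕜, E) 𝓘(𝕜, W) ∞ fun g => ρ g v)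

include hρ in
theorem contDiffOn_chart (v : W) :
    ContDiffOn 𝕜 ∞ (fun y => ρ (oneChartSymm 𝕜 E G y) v)
      (extChartAt 𝓘(𝕜, E) (1 : G)).target := by
  have : IsManifold 𝓘(𝕜, E) ∞ G :=
    ‹LieGroup 𝓘(𝕜, E) ∞ G›.toContMDiffMul.toIsManifold
  exact contMDiffOn_iff_contDiffOn.1 <|
    (hρ v).comp_contMDiffOn (contMDiffOn_extChartAt_symm (n := ∞) (I := 𝓘(𝕜, E)) (1 : G))

include hρ in
theorem differentiableAt_chart (v : W) {y : E} (hy : y ∈ (extChartAt 𝓘(𝕜, E) (1 : G)).target) :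
    DifferentiableAt 𝕜 (fun y => ρ (oneChartSymm 𝕜 E G y) v) y :=
  ((contDiffOn_chart hρ v).differentiableOn (by simp)).differentiableAt
    ((isOpen_extChartAt_target _).mem_nhds hy)

variable [NormedAlgebra 𝕜 ℂ] [IsScalarTower 𝕜 ℂ W]
  {φ : GroupLieAlgebra 𝓘(𝕜, E) G →ₗ[𝕜] Module.End ℂ W}
  (hφ : ∀ X v, φ X v = mfderiv 𝓘(𝕜, E) 𝓘(𝕜, W) (fun g => ρ g v) 1 X)

omit [LieGroup 𝓘(𝕜, E) ∞ G] in
include hρ hφ in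
/-- At the identity, the derivative of the action in the chart is the action of the Lie algebra. -/
theorem fderiv_chart_one (X : GroupLieAlgebra 𝓘(𝕜, E) G) (v : W) :
    fderiv 𝕜 (fun y => ρ (oneChartSymm 𝕜 E G y) v) (extChartAt 𝓘(𝕜, E) (1 : G) 1) X = φ X v := by
  have h : mfderiv 𝓘(𝕜, E) 𝓘(𝕜, W) (fun g => ρ g v) 1 =
      fderiv 𝕜 (fun y => ρ (oneChartSymm 𝕜 E G y) v) (extChartAt 𝓘(𝕜, E) (1 : G) 1) := by
    unfold mfderiv
    refine (if_pos ((hρ v).mdifferentiableAt (by simp))).trans ?_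
    simp only [writtenInExtChartAt, Function.comp_def, oneChartSymm, extChartAt_model_space_eq_id,
      PartialEquiv.refl_coe, id, modelWithCornersSelf_coe, range_id, fderivWithin_univ]
    rfl
  rw [hφ, h]
  rfl

include hρ hφ in
/-- The derivative at a point `y` of the chart differs from the one at the identity by a left
translation, so it is the action of an element of the Lie algebra followed by that of the group
element which corresponds to `y`. -/
theorem exists_fderiv_chart [FiniteDimensional ℂ W] {y : E}
    (hy : y ∈ (extChartAt 𝓘(𝕜, E) (1 : G)).target) (η : E) :
    ∃ X, ∀ v, fderiv 𝕜 (fun y => ρ (oneChartSymm 𝕜 E G y) v) y η =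
      ρ (oneChartSymm 𝕜 E G y) (φ X v) := by
  have : IsManifold 𝓘(𝕜, E) ∞ G :=
    ‹LieGroup 𝓘(𝕜, E) ∞ G›.toContMDiffMul.toIsManifold
  set g₀ := oneChartSymm 𝕜 E G y with hg₀
  let c : E → G := fun z => g₀⁻¹ * oneChartSymm 𝕜 E G z
  have hc : MDifferentiableAt 𝓘(𝕜, E) 𝓘(𝕜, E) c y := by
    have h1 : MDifferentiableAt 𝓘(𝕜, E) 𝓘(𝕜, E) (oneChartSymm 𝕜 E G) y :=
      ((contMDiffOn_extChartAt_symm (n := ∞) (I := 𝓘(𝕜, E)) (1 : G)).contMDiffAt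
        ((isOpen_extChartAt_target _).mem_nhds hy)).mdifferentiableAt (by simp)
    exact ((contMDiff_mul_left (I := 𝓘(𝕜, E)) (n := ∞) (a := g₀⁻¹)).mdifferentiableAt
      (by simp)).comp y h1
  have hc1 : c y = 1 := inv_mul_cancel g₀
  refine ⟨mfderiv 𝓘(𝕜, E) 𝓘(𝕜, E) c y η, fun v => ?_⟩
  let T : W →L[𝕜] W := (LinearMap.toContinuousLinearMap (ρ g₀)).restrictScalars 𝕜
  have hv : MDifferentiableAt 𝓘(𝕜, E) 𝓘(𝕜, W) (fun g => ρ g v) (1 : G) :=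
    (hρ v).mdifferentiableAt (by simp)
  have e1 : (fun z => ρ (oneChartSymm 𝕜 E G z) v) = T ∘ ((fun g => ρ g v) ∘ c) := by
    funext z
    change _ = ρ g₀ (ρ (g₀⁻¹ * _) v)
    rw [← Module.End.mul_apply, ← map_mul, mul_inv_cancel_left]
  have hd : DifferentiableAt 𝕜 ((fun g => ρ g v) ∘ c) y :=
    mdifferentiableAt_iff_differentiableAt.1 (MDifferentiableAt.comp_of_eq y hv hc hc1)
  rw [e1, (T.hasFDerivAt.comp y hd.hasFDerivAt).fderiv]
  have e2 := mfderiv_comp_of_eq (x := y) hv hc hc1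
  rw [mfderiv_eq_fderiv] at e2
  refine congrArg (ρ g₀) (Eq.trans ?_ (hφ (mfderiv 𝓘(𝕜, E) 𝓘(𝕜, E) c y η) v).symm)
  refine (DFunLike.congr_fun e2 η).trans ?_
  -- `c y` equals `1` only propositionally, so the point of differentiation has to be generalized
  have e3 : ∀ g : G, g = 1 → (mfderiv 𝓘(𝕜, E) 𝓘(𝕜, W) (fun g => ρ g v) g : E →L[𝕜] W) =
      mfderiv 𝓘(𝕜, E) 𝓘(𝕜, W) (fun g => ρ g v) (1 : G) := by
    rintro _ rfl
    rfl
  exact DFunLike.congr_fun (e3 (c y) hc1) _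

include hρ in
/-- Segments in the chart are parametrized by a real variable, also when `𝕜` is `ℂ`. -/
theorem hasDerivAt_line (v : W) {y η : E} {t : ℝ}
    (ht : y + (t : 𝕜) • η ∈ (extChartAt 𝓘(𝕜, E) (1 : G)).target) :
    HasDerivAt (fun s : ℝ => ρ (oneChartSymm 𝕜 E G (y + (s : 𝕜) • η)) v)
      (fderiv 𝕜 (fun z => ρ (oneChartSymm 𝕜 E G z) v) (y + (t : 𝕜) • η) η) t := by
  have := isScalarTower_real 𝕜 W
  have h1 : HasDerivAt (fun s : 𝕜 => y + s • η) η (t : 𝕜) := by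
    simpa using ((hasDerivAt_id (t : 𝕜)).smul_const η).const_add y
  have h2 := (differentiableAt_chart hρ v ht).hasFDerivAt.comp_hasDerivAt (t : 𝕜) h1
  have h3 : HasDerivAt (fun s : ℝ => (s : 𝕜)) (1 : 𝕜) t := by
    simpa using (RCLike.ofRealCLM (K := 𝕜)).hasDerivAt (x := t)
  simpa [Function.comp_def] using HasDerivAt.scomp t h2 h3

include hρ hφ in
/-- Every element of the Lie algebra acts as the derivative of the action of the group along a
curve through the identity. -/
theorem exists_curve_one (X : GroupLieAlgebra 𝓘(𝕜, E) G) : ∃ γ : ℝ → G, γ 0 = 1 ∧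
    ∀ v, HasDerivAt (fun s => ρ (γ s) v) (φ X v) 0 := by
  let η : E := X
  refine ⟨fun s => oneChartSymm 𝕜 E G (extChartAt 𝓘(𝕜, E) (1 : G) 1 + (s : 𝕜) • η), ?_, ?_⟩
  · simp [oneChartSymm]
  · intro v
    have := hasDerivAt_line (𝕜 := 𝕜) hρ v (y := extChartAt 𝓘(𝕜, E) (1 : G) 1) (η := η) (t := 0)
      (by simp)
    rw [← fderiv_chart_one hρ hφ X v]
    refine this.congr_deriv ?_
    rw [RCLike.ofReal_zero, zero_smul, add_zero]

omit [TopologicalSpace G] in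
/-- An action of a group is jointly continuous along curves on which it is pointwise continuous. -/
theorem continuousOn_rep [FiniteDimensional ℂ W] {S : Set ℝ} {γ : ℝ → G} {f : ℝ → W}
    (hγ : ∀ v, ContinuousOn (fun t => ρ (γ t) v) S) (hf : ContinuousOn f S) :
    ContinuousOn (fun t => ρ (γ t) (f t)) S := by
  let b := Module.finBasis ℂ W
  have e : (fun t => ρ (γ t) (f t)) = fun t => ∑ i, b.coord i (f t) • ρ (γ t) (b i) := by
    funext t
    conv_lhs => rw [← b.sum_repr (f t), map_sum]
    simp only [map_smul, Module.Basis.coord_apply]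
  rw [e]
  exact continuousOn_finsetSum _ fun i _ =>
    ((b.coord i).continuous_of_finiteDimensional.comp_continuousOn hf).smul (hγ _)

include hρ hφ in
/-- Near the identity, group elements are joined to `1` by curves `γ` along which the action of `G`
satisfies a linear differential equation with coefficients in the image of the Lie algebra. -/
theorem exists_curves [FiniteDimensional ℂ W] : ∃ U ∈ 𝓝 (1 : G), ∀ g ∈ U,
    ∃ (γ : ℝ → G) (X : ℝ → GroupLieAlgebra 𝓘(𝕜, E) G), γ 0 = 1 ∧ γ 1 = g ∧
      (∀ t ∈ Icc (0 : ℝ) 1, ∀ v, HasDerivAt (fun s => ρ (γ s) v) (ρ (γ t) (φ (X t) v)) t) ∧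
      ∀ v, ContinuousOn (fun t => φ (X t) v) (Icc 0 1) := by
  have : IsTopologicalGroup G := topologicalGroup_of_lieGroup 𝓘(𝕜, E) ∞
  set e := extChartAt 𝓘(𝕜, E) (1 : G) with he
  have hT : IsOpen e.target := isOpen_extChartAt_target _
  obtain ⟨r, hr, hball⟩ := Metric.isOpen_iff.1 hT (e 1) (mem_extChartAt_target 1)
  refine ⟨e.source ∩ e ⁻¹' Metric.ball (e 1) r, Filter.inter_mem (extChartAt_source_mem_nhds _)
    ((continuousAt_extChartAt _).preimage_mem_nhds (Metric.ball_mem_nhds _ hr)), ?_⟩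
  rintro g ⟨hg, hgr⟩
  let η : E := e g - e 1
  let y : ℝ → E := fun t => e 1 + (t : 𝕜) • η
  have hy : ∀ t ∈ Icc (0 : ℝ) 1, y t ∈ e.target := by
    intro t ht
    apply hball
    have h1 : ‖η‖ < r := by simpa [η, dist_eq_norm] using hgr
    have h2 : ‖(t : 𝕜)‖ ≤ 1 := by rw [RCLike.norm_ofReal, abs_of_nonneg ht.1]; exact ht.2
    simp only [y, Metric.mem_ball, dist_eq_norm, add_sub_cancel_left, norm_smul]
    exact (mul_le_of_le_one_left (norm_nonneg _) h2).trans_lt h1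
  have hyc : Continuous y := by fun_prop
  have hX : ∀ t : ℝ, ∃ X, t ∈ Icc (0 : ℝ) 1 → ∀ v,
      fderiv 𝕜 (fun y => ρ (oneChartSymm 𝕜 E G y) v) (y t) η =
        ρ (oneChartSymm 𝕜 E G (y t)) (φ X v) := by
    intro t
    by_cases ht : t ∈ Icc (0 : ℝ) 1
    · obtain ⟨X, hX⟩ := exists_fderiv_chart hρ hφ (hy t ht) η
      exact ⟨X, fun _ => hX⟩
    · exact ⟨0, fun h => absurd h ht⟩
  choose X hX using hX
  have hγc : ContinuousOn (fun t => oneChartSymm 𝕜 E G (y t)) (Icc 0 1) :=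
    (continuousOn_extChartAt_symm (1 : G)).comp hyc.continuousOn hy
  refine ⟨fun t => oneChartSymm 𝕜 E G (y t), X, by simp [y, oneChartSymm, e], ?_,
    fun t ht v => ?_, fun v => ?_⟩
  · have : e.symm (e g) = g := e.left_inv hg
    simpa only [y, η, oneChartSymm, RCLike.ofReal_one, one_smul, add_sub_cancel]
  · rw [← hX t ht v]
    exact hasDerivAt_line hρ v (hy t ht)
  · -- `φ (X t) v` is recovered from the derivative by applying the inverse group element
    have h1 : ContinuousOn (fun t => fderiv 𝕜 (fun y => ρ (oneChartSymm 𝕜 E G y) v) (y t) η)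
        (Icc 0 1) := by
      have := (contDiffOn_chart (𝕜 := 𝕜) (E := E) hρ v).continuousOn_fderiv_of_isOpen hT
        (by simp)
      exact (this.comp hyc.continuousOn hy).clm_apply continuousOn_const
    have h2 := continuousOn_rep (γ := fun t => (oneChartSymm 𝕜 E G (y t))⁻¹)
      (fun v => (hρ v).continuous.comp_continuousOn hγc.inv) h1
    refine h2.congr fun t ht => ?_
    change _ = ρ _ (fderiv 𝕜 (fun y => ρ (oneChartSymm 𝕜 E G y) v) (y t) η)
    rw [hX t ht v, ← Module.End.mul_apply, ← map_mul, inv_mul_cancel, map_one,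
      Module.End.one_apply]

end LieGroup

/-! ### Stability of subspaces of tensor powers under the group -/

section TensorPower

variable {W : Type*} [AddCommGroup W] [Module ℂ W]

theorem tensorDiag_tprod (k : ℕ) (B : Module.End ℂ W) (v : Fin k → W) :
    tensorDiag k B (PiTensorProduct.tprod ℂ v) = PiTensorProduct.tprod ℂ fun i => B (v i) :=
  PiTensorProduct.map_tprod _ _

theorem tensorDiag_tensorPow (k : ℕ) (B : Module.End ℂ W) (v : W) :
    tensorDiag k B (tensorPow k v) = tensorPow k (B v) := tensorDiag_tprod k B _

theorem tensorDiag_one (k : ℕ) : tensorDiag k (1 : Module.End ℂ W) = 1 := PiTensorProduct.map_id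

theorem tensorDiag_mul (k : ℕ) (A B : Module.End ℂ W) :
    tensorDiag k (A * B) = tensorDiag k A * tensorDiag k B := PiTensorProduct.map_comp _ _

end TensorPower

section Curves

variable {W : Type*} [NormedAddCommGroup W] [NormedSpace ℂ W] [FiniteDimensional ℂ W]

/-- The derivative of the diagonal action is the derivation action. It is stated after applying
linear functionals since tensor powers carry no norm. -/
theorem hasDerivAt_tensorDiag (k : ℕ) {R : ℝ → Module.End ℂ W} {A : Module.End ℂ W} {t : ℝ}
    (h : ∀ v, HasDerivAt (fun s => R s v) (R t (A v)) t) (l : Module.Dual ℂ (⨂[ℂ]^k W))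
    (x : ⨂[ℂ]^k W) :
    HasDerivAt (fun s => l (tensorDiag k (R s) x))
      (l (tensorDiag k (R t) (tensorDer k A x))) t := by
  induction x using PiTensorProduct.induction_on with
  | smul_tprod r v =>
    simp only [map_smul, tensorDer_tprod, tensorDiag_tprod, map_sum]
    refine ((hasDerivAt_multilinearMap (l.compMultilinearMap (PiTensorProduct.tprod ℂ))
      fun i => h (v i)).const_smul r).congr_deriv ?_
    congr 1
    refine Finset.sum_congr rfl fun i _ => ?_
    refine congrArg (fun u => l (PiTensorProduct.tprod ℂ u)) (funext fun j => ?_)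
    by_cases hj : j = i
    · subst hj
      simp
    · simp [hj]
  | add x y hx hy => simpa only [map_add] using hx.fun_add hy

theorem continuousOn_tensorDer (k : ℕ) {S : Set ℝ} {A : ℝ → Module.End ℂ W}
    (h : ∀ v, ContinuousOn (fun t => A t v) S) (l : Module.Dual ℂ (⨂[ℂ]^k W)) (x : ⨂[ℂ]^k W) :
    ContinuousOn (fun t => l (tensorDer k (A t) x)) S := by
  induction x using PiTensorProduct.induction_on with
  | smul_tprod r v =>
    simp only [map_smul, tensorDer_tprod, map_sum]
    refine (continuousOn_finsetSum _ fun i _ => ?_).const_smul r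
    have hm := continuous_multilinearMap (l.compMultilinearMap (PiTensorProduct.tprod ℂ))
    refine hm.comp_continuousOn (continuousOn_pi.2 fun j => ?_)
    by_cases hj : j = i
    · subst hj
      simpa using h (v j)
    · simpa [hj] using continuousOn_const
  | add x y hx hy => simpa only [map_add] using hx.fun_add hy

end Curves

/-- In a connected group, a property that holds near `1` and is inherited by products holds
everywhere. -/
theorem connected_group_induction {G : Type*} [TopologicalSpace G] [Group G]
    [IsTopologicalGroup G] [ConnectedSpace G] {P : G → Prop} (hP : ∀ᶠ g in 𝓝 1, P g)
    (hmul : ∀ a b, P a → P b → P (a * b)) (g : G) : P g := by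
  let S : Set G := {g | P g ∧ P g⁻¹}
  have hS : S ∈ 𝓝 (1 : G) := by
    refine hP.and ?_
    have : Tendsto (fun g : G => g⁻¹) (𝓝 1) (𝓝 1) := by
      simpa using (continuous_inv (G := G)).tendsto 1
    exact this.eventually hP
  have hopen : IsOpen (Subgroup.closure S : Set G) :=
    Subgroup.isOpen_of_mem_nhds _ (mem_of_superset hS Subgroup.subset_closure)
  have huniv : (Subgroup.closure S : Set G) = univ :=
    IsClopen.eq_univ ⟨Subgroup.isClosed_of_isOpen _ hopen, hopen⟩ ⟨1, one_mem _⟩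
  have hg : g ∈ Subgroup.closure S := by
    rw [← SetLike.mem_coe, huniv]
    trivial
  suffices h : P g ∧ P g⁻¹ from h.1
  induction hg using Subgroup.closure_induction with
  | mem x hx => exact hx
  | one => exact ⟨hP.self_of_nhds, by simpa using hP.self_of_nhds⟩
  | mul x y _ _ hx hy =>
    exact ⟨hmul _ _ hx.1 hy.1, by rw [mul_inv_rev]; exact hmul _ _ hy.2 hx.2⟩
  | inv x _ hx => exact ⟨hx.2, by rw [inv_inv]; exact hx.1⟩

section LieGroup

variable {𝕜 : Type*} [RCLike 𝕜] [NormedAlgebra 𝕜 ℂ]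
  {E : Type*} [NormedAddCommGroup E] [NormedSpace 𝕜 E]
  {G : Type*} [TopologicalSpace G] [ChartedSpace E G] [Group G] [LieGroup 𝓘(𝕜, E) ∞ G]
  {W : Type*} [NormedAddCommGroup W] [NormedSpace ℂ W] [FiniteDimensional ℂ W]
  [NormedSpace 𝕜 W] [IsScalarTower 𝕜 ℂ W] {ρ : Representation ℂ G W}
  (hρ : ∀ v, ContMDiff 𝓘(𝕜, E) 𝓘(𝕜, W) ∞ fun g => ρ g v)
  {φ : GroupLieAlgebra 𝓘(𝕜, E) G →ₗ[𝕜] Module.End ℂ W}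
  (hφ : ∀ X v, φ X v = mfderiv 𝓘(𝕜, E) 𝓘(𝕜, W) (fun g => ρ g v) 1 X)

include hρ hφ in
/-- For a connected group, subspaces of `W^{⊗k}` which are stable under the Lie algebra are stable
under the group. -/
theorem tensorDiag_mem_of_tensorDer_mem [ConnectedSpace G] {k : ℕ} {p : Submodule ℂ (⨂[ℂ]^k W)}
    (hp : ∀ X, ∀ x ∈ p, tensorDer k (φ X) x ∈ p) (g : G) :
    ∀ x ∈ p, tensorDiag k (ρ g) x ∈ p := by
  have : IsTopologicalGroup G := topologicalGroup_of_lieGroup 𝓘(𝕜, E) ∞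
  refine connected_group_induction (P := fun g => ∀ x ∈ p, tensorDiag k (ρ g) x ∈ p) ?_
    (fun a b ha hb x hx => ?_) g
  · obtain ⟨U, hU, H⟩ := exists_curves hρ hφ
    filter_upwards [hU] with g hg x hx
    obtain ⟨γ, X, h0, h1, hd, hc⟩ := H g hg
    rw [← h1]
    refine mem_of_hasDerivAt_comp p (R := fun t => tensorDiag k (ρ (γ t)))
      (A := fun t => tensorDer k (φ (X t))) (fun t _ => hp (X t)) (fun x hx => ?_)
      (continuousOn_tensorDer k hc)
      (fun l x t ht => hasDerivAt_tensorDiag k (R := fun t => ρ (γ t)) (hd t ht) l x)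
      (right_mem_Icc.2 zero_le_one) hx
    rwa [h0, map_one, tensorDiag_one]
  · rw [map_mul, tensorDiag_mul]
    exact ha _ (hb x hx)

include hρ hφ in
/-- The module `W^{[k]}` is the linear span of the orbit of `w^{⊗k}`. -/
theorem level_eq_span [ConnectedSpace G] (w : W) (k : ℕ) :
    level φ w k = Submodule.span ℂ (range fun g => tensorPow k (ρ g w)) := by
  apply le_antisymm
  · refine level_le (Submodule.subset_span ⟨1, by simp⟩) fun X x hx => ?_
    induction hx using Submodule.span_induction with
    | zero => simp
    | add x y _ _ hx hy => rw [map_add]; exact add_mem hx hy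
    | smul r x _ hx => rw [map_smul]; exact Submodule.smul_mem _ r hx
    | mem x hx =>
      obtain ⟨g, rfl⟩ := hx
      by_contra hX
      -- a functional that vanishes on the span but not at the derivative is impossible
      obtain ⟨l, hl, hlp⟩ := Submodule.exists_le_ker_of_notMem hX
      obtain ⟨γ, h0, hd⟩ := exists_curve_one hρ hφ X
      have h := hasDerivAt_tensorDiag k (R := fun t => ρ (γ t)) (A := φ X) (t := 0)
        (by simpa [h0] using hd) l (tensorPow k (ρ g w))
      have hz : ∀ s, l (tensorDiag k (ρ (γ s)) (tensorPow k (ρ g w))) = 0 := by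
        intro s
        refine hlp (Submodule.subset_span ⟨γ s * g, ?_⟩)
        simp only [map_mul, Module.End.mul_apply]
        exact (tensorDiag_tensorPow k _ _).symm
      simp only [hz, h0, map_one, tensorDiag_one, Module.End.one_apply] at h
      exact hl (h.unique (hasDerivAt_const 0 0))
  · rw [Submodule.span_le]
    rintro _ ⟨g, rfl⟩
    rw [SetLike.mem_coe]
    dsimp only
    rw [← tensorDiag_tensorPow]
    exact tensorDiag_mem_of_tensorDer_mem hρ hφ (fun X x hx => tensorDer_mem φ w k X hx) g _
      (tensorPow_mem φ w k)

end LieGroup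

end Analysis

universe u

/-! ### Polynomials as functionals on the modules `W^{[k]}` -/

section Comparison

variable {W : Type u} [AddCommGroup W] [Module ℂ W] {𝔞 : Type*} (φ : 𝔞 → Module.End ℂ W) (w : W)

/-- The product `ξ₁ ⋯ ξₖ` of linear forms as a functional on `W^{[k]} ⊆ W^{⊗k}`. -/
noncomputable def levelProd {k : ℕ} (ξ : Fin k → Module.Dual ℂ W) : DualLevel φ w k :=
  PiTensorProduct.dualDistrib (PiTensorProduct.tprod ℂ ξ) ∘ₗ (level φ w k).subtype

theorem dualMul_levelProd {k : ℕ} (ξ : Fin (k + 1) → Module.Dual ℂ W) :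
    dualMul φ w k 1 (levelProd φ w fun i => ξ i.castSucc)
      (levelProd φ w fun _ => ξ (Fin.last k)) = levelProd φ w ξ := by
  rw [levelProd, levelProd, dualMul_restrict, levelProd]
  congr 1
  ext v
  simp only [LinearMap.compMultilinearMap_apply, fullMul_tprod, PiTensorProduct.dualDistrib_apply]
  rw [Fin.prod_univ_castSucc (n := k), Fin.prod_univ_one]
  rfl

/-- The homomorphism `S^*(W^*) → W^{[*]}` that restricts polynomials, regarded as functionals on
tensor powers, to the submodules `W^{[k]}`. -/
noncomputable def toLevel : Poly W →ₐ[ℂ] LevelAlgebra φ w :=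
  SymmetricAlgebra.lift
    (DirectSum.lof ℂ ℕ (DualLevel φ w) 1 ∘ₗ (level φ w 1).subtype.dualMap ∘ₗ
      PiTensorProduct.dualDistrib ∘ₗ (PiTensorProduct.subsingletonEquiv (R := ℂ)
        (s := fun _ : Fin 1 => Module.Dual ℂ W) 0).symm.toLinearMap)

theorem toLevel_ι (ξ : Module.Dual ℂ W) :
    toLevel φ w (SymmetricAlgebra.ι ℂ _ ξ) =
      DirectSum.lof ℂ ℕ (DualLevel φ w) 1 (levelProd φ w fun _ => ξ) := by
  rw [toLevel, SymmetricAlgebra.lift_ι_apply]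
  simp only [LinearMap.comp_apply, LinearEquiv.coe_coe,
    PiTensorProduct.subsingletonEquiv_symm_apply']
  rfl

theorem lof_mul_lof {i j : ℕ} (f : DualLevel φ w i) (g : DualLevel φ w j) :
    DirectSum.lof ℂ ℕ (DualLevel φ w) i f * DirectSum.lof ℂ ℕ (DualLevel φ w) j g =
      DirectSum.lof ℂ ℕ (DualLevel φ w) (i + j) (dualMul φ w i j f g) :=
  DirectSum.of_mul_of f g

/-- The homomorphism `toLevel` sends a product of linear forms to its restriction to `W^{[k]}`. -/
theorem toLevel_prod {k : ℕ} (ξ : Fin k → Module.Dual ℂ W) :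
    toLevel φ w (∏ i, SymmetricAlgebra.ι ℂ _ (ξ i)) =
      DirectSum.lof ℂ ℕ (DualLevel φ w) k (levelProd φ w ξ) := by
  induction k with
  | zero =>
    rw [Fin.prod_univ_zero, map_one]
    refine congrArg (DirectSum.lof ℂ ℕ (DualLevel φ w) 0) (?_ : dualOne φ w = _)
    rw [dualOne, levelProd]
    congr 1
    ext v
    simp [fullOne_tprod]
  | succ k ih =>
    rw [Fin.prod_univ_castSucc, map_mul, ih, toLevel_ι, lof_mul_lof, dualMul_levelProd]

theorem prod_mem_homogPoly {k : ℕ} (ξ : Fin k → Module.Dual ℂ W) :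
    ∏ i, SymmetricAlgebra.ι ℂ _ (ξ i) ∈ homogPoly W k := by
  induction k with
  | zero =>
    rw [Fin.prod_univ_zero]
    exact SetLike.one_mem_graded _
  | succ k ih =>
    rw [Fin.prod_univ_castSucc]
    exact SetLike.mul_mem_graded (ih _) (ι_mem W _)

/-- Every functional on `W^{[k]}` is the restriction of a homogeneous polynomial. -/
theorem exists_toLevel_eq [FiniteDimensional ℂ W] {k : ℕ} (f : DualLevel φ w k) :
    ∃ P ∈ homogPoly W k, toLevel φ w P = DirectSum.lof ℂ ℕ (DualLevel φ w) k f := by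
  obtain ⟨F, rfl⟩ := exists_full φ w f
  obtain ⟨t, rfl⟩ :=
    (PiTensorProduct.dualDistribEquiv (R := ℂ) (M := fun _ : Fin k => W)).surjective F
  induction t using PiTensorProduct.induction_on with
  | smul_tprod r ξ =>
    refine ⟨r • ∏ i, SymmetricAlgebra.ι ℂ _ (ξ i), Submodule.smul_mem _ _ (prod_mem_homogPoly ξ),
      ?_⟩
    rw [map_smul, toLevel_prod, ← map_smul]
    refine congrArg _ ?_
    rw [map_smul, LinearMap.smul_comp]
    rfl
  | add x y hx hy =>
    obtain ⟨P, hP, eP⟩ := hx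
    obtain ⟨Q, hQ, eQ⟩ := hy
    exact ⟨P + Q, add_mem hP hQ, by rw [map_add, eP, eQ, map_add, LinearMap.add_comp, map_add]⟩

theorem toLevel_surjective [FiniteDimensional ℂ W] : Function.Surjective (toLevel φ w) := by
  intro (x : ⨁ k, DualLevel φ w k)
  induction x using DirectSum.induction_on with
  | zero => exact ⟨0, map_zero _⟩
  | of k f =>
    obtain ⟨P, -, hP⟩ := exists_toLevel_eq φ w f
    exact ⟨P, hP⟩
  | add x y hx hy =>
    obtain ⟨P, rfl⟩ := hx
    obtain ⟨Q, rfl⟩ := hy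
    exact ⟨P + Q, map_add _ _ _⟩

/-- On homogeneous polynomials, `toLevel` is compatible with degrees and with evaluation at vectors
`v` such that `v^{⊗k}` belongs to `W^{[k]}` for all `k`. -/
theorem exists_toLevel_eq_lof {k : ℕ} {P : Poly W} (hP : P ∈ homogPoly W k) :
    ∃ F : DualLevel φ w k, toLevel φ w P = DirectSum.lof ℂ ℕ (DualLevel φ w) k F ∧
      ∀ (v : W) (hv : ∀ k, tensorPow k v ∈ level φ w k), F ⟨tensorPow k v, hv k⟩ = evalAt v P := by
  induction hP using Submodule.pow_induction_on_right' with
  | algebraMap r =>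
    refine ⟨r • dualOne φ w, AlgHom.commutes _ r, fun v hv => ?_⟩
    simp [dualOne, tensorPow, fullOne_tprod]
  | add P Q k _ _ hP hQ =>
    obtain ⟨F, eF, hF⟩ := hP
    obtain ⟨F', eF', hF'⟩ := hQ
    exact ⟨F + F', by rw [map_add, eF, eF', map_add], fun v hv => by
      rw [map_add, LinearMap.add_apply, hF, hF']⟩
  | mul_mem k P _ hP m hm =>
    obtain ⟨F, eF, hF⟩ := hP
    obtain ⟨ξ, rfl⟩ := hm
    refine ⟨dualMul φ w k 1 F (levelProd φ w fun _ => ξ), by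
      rw [map_mul, eF, toLevel_ι, lof_mul_lof], fun v hv => ?_⟩
    rw [map_mul, ← hF v hv]
    obtain ⟨F, rfl⟩ := exists_full φ w F
    rw [levelProd, dualMul_restrict]
    simp only [tensorPow, LinearMap.comp_apply, Submodule.subtype_apply]
    rw [fullMul_tprod, PiTensorProduct.dualDistrib_apply]
    simp [evalAt]

/-- The component of degree `k` of `toLevel`. -/
noncomputable def toDualLevel (k : ℕ) : homogPoly W k →ₗ[ℂ] DualLevel φ w k :=
  DirectSum.component ℂ ℕ (DualLevel φ w) k ∘ₗ (toLevel φ w).toLinearMap ∘ₗ (homogPoly W k).subtype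

theorem toLevel_coe {k : ℕ} (P : homogPoly W k) :
    toLevel φ w P = DirectSum.lof ℂ ℕ (DualLevel φ w) k (toDualLevel φ w k P) := by
  obtain ⟨F, hF, -⟩ := exists_toLevel_eq_lof φ w P.2
  simp [toDualLevel, hF, DirectSum.component.lof_self]

theorem toDualLevel_tensorPow {k : ℕ} (P : homogPoly W k) {v : W}
    (hv : ∀ k, tensorPow k v ∈ level φ w k) :
    toDualLevel φ w k P ⟨tensorPow k v, hv k⟩ = evalAt v (P : Poly W) := by
  obtain ⟨F, hF, h⟩ := exists_toLevel_eq_lof φ w P.2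
  rw [← h v hv]
  simp [toDualLevel, hF, DirectSum.component.lof_self]

theorem toDualLevel_surjective [FiniteDimensional ℂ W] (k : ℕ) :
    Function.Surjective (toDualLevel φ w k) := by
  intro f
  obtain ⟨P, hP, h⟩ := exists_toLevel_eq φ w f
  exact ⟨⟨P, hP⟩, by simp [toDualLevel, h, DirectSum.component.lof_self]⟩

theorem toDualLevel_mul {i j : ℕ} (P : homogPoly W i) (Q : homogPoly W j) :
    toDualLevel φ w (i + j) (homogMul i j P Q) =
      dualMul φ w i j (toDualLevel φ w i P) (toDualLevel φ w j Q) := by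
  have h : toLevel φ w (homogMul i j P Q : Poly W) = toLevel φ w P * toLevel φ w Q :=
    map_mul (toLevel φ w) (P : Poly W) Q
  rw [toLevel_coe, toLevel_coe, toLevel_coe, lof_mul_lof] at h
  exact DirectSum.of_injective _ h

variable {φ w} {G : Type*} [Group G] {ρ : Representation ℂ G W}
  (hspan : ∀ k, level φ w k = Submodule.span ℂ (Set.range fun g => tensorPow k (ρ g w)))

include hspan in
theorem tensorPow_rep_mem (g : G) (k : ℕ) : tensorPow k (ρ g w) ∈ level φ w k := by
  rw [hspan]
  exact Submodule.subset_span ⟨g, rfl⟩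

include hspan in
/-- A polynomial restricts to zero on `W^{[k]}`, which is spanned by the tensors `(g w)^{⊗k}`, if
and only if it vanishes at all vectors `g w`. -/
theorem ker_toDualLevel (hw : w ≠ 0) (k : ℕ) :
    LinearMap.ker (toDualLevel φ w k) = vanishing ρ w k := by
  have hg : ∀ g, ρ g w ≠ 0 := fun g h => hw (by
    have := congrArg (ρ g⁻¹) h
    rwa [map_zero, ← Module.End.mul_apply, ← map_mul, inv_mul_cancel, map_one,
      Module.End.one_apply] at this)
  ext P
  rw [LinearMap.mem_ker, mem_vanishing_iff]
  constructor
  · intro h g _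
    rw [← toDualLevel_tensorPow φ w P (tensorPow_rep_mem hspan g), h, LinearMap.zero_apply]
  · intro h
    obtain ⟨F, hF⟩ := exists_full φ w (toDualLevel φ w k P)
    have hle : level φ w k ≤ LinearMap.ker F := by
      conv_lhs => rw [hspan]
      rw [Submodule.span_le]
      rintro _ ⟨g, rfl⟩
      have := toDualLevel_tensorPow φ w P (tensorPow_rep_mem hspan g)
      rw [h g (hg g), hF] at this
      exact this
    ext x
    rw [hF]
    exact hle x.2

/-- The graded pieces of the homogeneous coordinate ring of `N_w` are dual to the modules
`W^{[k]}`. -/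
noncomputable def sectionsEquiv [FiniteDimensional ℂ W] (hw : w ≠ 0) (k : ℕ) :
    Sections ρ w k ≃ₗ[ℂ] DualLevel φ w k :=
  (Submodule.quotEquivOfEq _ _ (ker_toDualLevel hspan hw k).symm).trans
    ((toDualLevel φ w k).quotKerEquivOfSurjective (toDualLevel_surjective φ w k))

theorem sectionsEquiv_mk [FiniteDimensional ℂ W] (hw : w ≠ 0) (k : ℕ) (P : homogPoly W k) :
    sectionsEquiv hspan hw k (Submodule.Quotient.mk P) = toDualLevel φ w k P := rfl

/-- The isomorphism `W^{[k]} ≅ Γ(N_w, O(k))^*`. -/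
noncomputable def levelEquiv [FiniteDimensional ℂ W] (hw : w ≠ 0) (k : ℕ) :
    level φ w k ≃ₗ[ℂ] Module.Dual ℂ (Sections ρ w k) :=
  (Module.evalEquiv ℂ (level φ w k)).trans (sectionsEquiv hspan hw k).dualMap

theorem levelEquiv_apply [FiniteDimensional ℂ W] (hw : w ≠ 0) (k : ℕ) (x : level φ w k)
    (a : Sections ρ w k) : levelEquiv hspan hw k x a = sectionsEquiv hspan hw k a x := rfl

/-- The multiplication of sections is dual to the inclusions `m_{i,j}`. -/
theorem levelEquiv_mul [FiniteDimensional ℂ W] (hw : w ≠ 0) (i j : ℕ) (x : level φ w (i + j))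
    (a : Sections ρ w i) (b : Sections ρ w j) :
    levelEquiv hspan hw (i + j) x (sectionsMul ρ w i j a b) =
      TensorProduct.dualDistrib ℂ _ _
        (TensorProduct.map (levelEquiv hspan hw i).toLinearMap (levelEquiv hspan hw j).toLinearMap
          (comul φ w i j x)) (a ⊗ₜ b) := by
  obtain ⟨P, rfl⟩ := Submodule.Quotient.mk_surjective _ a
  obtain ⟨Q, rfl⟩ := Submodule.Quotient.mk_surjective _ b
  rw [sectionsMul_mk, levelEquiv_apply, sectionsEquiv_mk, toDualLevel_mul, dualMul_apply]
  generalize comul φ w i j x = t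
  induction t with
  | zero => simp
  | add x y hx hy => simp only [map_add, LinearMap.add_apply, hx, hy]
  | tmul x y =>
    simp [levelEquiv_apply, sectionsEquiv_mk]

include hspan in
theorem tensorDiag_mem_level (k : ℕ) (g : G) : ∀ x ∈ level φ w k,
    tensorDiag k (ρ g) x ∈ level φ w k := by
  suffices h : level φ w k ≤ (level φ w k).comap (tensorDiag k (ρ g)) from h
  conv_lhs => rw [hspan]
  rw [Submodule.span_le]
  rintro _ ⟨h, rfl⟩
  have := tensorPow_rep_mem hspan (g * h) k
  rwa [map_mul, Module.End.mul_apply, ← tensorDiag_tensorPow] at this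

/-- The isomorphism `W^{[k]} ≅ Γ(N_w, O(k))^*` is `G`-equivariant. -/
theorem levelEquiv_tensorDiag [FiniteDimensional ℂ W] (hw : w ≠ 0) (k : ℕ) (g : G)
    (x : level φ w k) :
    levelEquiv hspan hw k ⟨tensorDiag k (ρ g) x, tensorDiag_mem_level hspan k g x x.2⟩ =
      (sectionsRep ρ w k).dual g (levelEquiv hspan hw k x) := by
  ext P
  obtain ⟨F, hF⟩ := exists_full φ w (toDualLevel φ w k P)
  obtain ⟨F', hF'⟩ := exists_full φ w (toDualLevel φ w k (homogPolyRep ρ k g⁻¹ P))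
  have e1 : toDualLevel φ w k P ⟨tensorDiag k (ρ g) x, tensorDiag_mem_level hspan k g x x.2⟩ =
      toDualLevel φ w k (homogPolyRep ρ k g⁻¹ P) x := by
    have hle : level φ w k ≤ LinearMap.eqLocus (F ∘ₗ tensorDiag k (ρ g)) F' := by
      conv_lhs => rw [hspan]
      rw [Submodule.span_le]
      rintro _ ⟨h, rfl⟩
      have h1 := toDualLevel_tensorPow φ w P (tensorPow_rep_mem hspan (g * h))
      have h2 := toDualLevel_tensorPow φ w (homogPolyRep ρ k g⁻¹ P) (tensorPow_rep_mem hspan h)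
      have h3 : evalAt (ρ h w) (homogPolyRep ρ k g⁻¹ P : Poly W) =
          evalAt (ρ (g * h) w) (P : Poly W) := by
        refine (evalAt_polyAct ρ g⁻¹ (ρ h w) P).trans ?_
        rw [inv_inv, map_mul, Module.End.mul_apply]
      rw [h3, ← h1, hF, hF'] at h2
      simp only [LinearMap.comp_apply, Submodule.subtype_apply, map_mul, Module.End.mul_apply] at h2
      change F (tensorDiag k (ρ g) (tensorPow k (ρ h w))) = _
      rw [tensorDiag_tensorPow, ← h2]
    rw [hF, hF']
    exact hle x.2
  exact e1

end Comparison

/-! ### Projective spectra and surjections of graded rings -/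

section Proj

open HomogeneousIdeal HomogeneousLocalization Graded

variable {A B : Type u} [CommRing A] [CommRing B] {σ τ : Type u} [SetLike σ A]
  [AddSubgroupClass σ A] [SetLike τ B] [AddSubgroupClass τ B] {𝒜 : ℕ → σ} {ℬ : ℕ → τ}
  [GradedRing 𝒜] [GradedRing ℬ] {ψ : 𝒜 →+*ᵍ ℬ} (hψ : Function.Surjective ψ)

include hψ in
/-- Homogeneous elements lift to homogeneous elements of the same degree. -/
theorem exists_mem_map_eq {k : ℕ} {b : B} (hb : b ∈ ℬ k) : ∃ a ∈ 𝒜 k, ψ a = b := by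
  obtain ⟨a, rfl⟩ := hψ b
  refine ⟨DirectSum.decompose 𝒜 a k, SetLike.coe_mem _, ?_⟩
  rw [ψ.map_directSumDecompose, DirectSum.decompose_of_mem_same ℬ hb]

include hψ in
theorem irrelevant_le_map : ℬ₊ ≤ 𝒜₊.map ψ := by
  rw [irrelevant_le]
  intro i hi b hb
  obtain ⟨a, ha, rfl⟩ := exists_mem_map_eq hψ hb
  exact Ideal.mem_map_of_mem ψ (mem_irrelevant_of_mem _ hi ha)

include hψ in
theorem awayMap_surjective {i : ℕ} {s : A} (hs : s ∈ 𝒜 i) :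
    Function.Surjective (Away.map ψ s : Away 𝒜 s →+* Away ℬ (ψ s)) := by
  intro x
  obtain ⟨n, b, hb, rfl⟩ := Away.mk_surjective ℬ (map_mem ψ hs) x
  obtain ⟨a, ha, rfl⟩ := exists_mem_map_eq hψ hb
  exact ⟨Away.mk 𝒜 hs n a ha, Away.map_mk ψ s hs n a ha⟩

/-- A surjective homomorphism of graded rings induces a closed immersion of projective spectra. -/
theorem isClosedImmersion_projMap :
    IsClosedImmersion (Proj.map ψ (irrelevant_le_map hψ)) := by
  set f := Proj.map ψ (irrelevant_le_map hψ) with hf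
  let U : (Σ i : PNat, 𝒜 i) → (Proj 𝒜).Opens := fun s => Proj.basicOpen 𝒜 (s.2 : A)
  have hU : ⨆ s, U s = ⊤ := by
    refine Proj.iSup_basicOpen_eq_top 𝒜 _ ?_
    rw [toIdeal_irrelevant_le]
    exact fun i hi x hx => Ideal.subset_span ⟨⟨⟨i, hi⟩, ⟨x, hx⟩⟩, rfl⟩
  refine (IsZariskiLocalAtTarget.iff_of_iSup_eq_top (P := @IsClosedImmersion) U hU).2 fun s => ?_
  let eA : (U s).toScheme ≅ Spec (.of (Away 𝒜 (s.2 : A))) :=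
    Proj.basicOpenIsoSpec 𝒜 (s.2 : A) s.2.2 s.1.2
  let eB : (f ⁻¹ᵁ U s).toScheme ≅ Spec (.of (Away ℬ (ψ (s.2 : A)))) :=
    Proj.basicOpenIsoSpec ℬ (ψ (s.2 : A)) (map_mem ψ s.2.2) s.1.2
  let c : Spec (.of (Away ℬ (ψ (s.2 : A)))) ⟶ Spec (.of (Away 𝒜 (s.2 : A))) :=
    Spec.map (CommRingCat.ofHom (Away.map ψ (s.2 : A)))
  have hc : IsClosedImmersion c :=
    IsClosedImmersion.spec_of_surjective _ (awayMap_surjective hψ s.2.2)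
  have h : (eB.inv ≫ (f ⁻¹ᵁ U s).ι) ≫ f = c ≫ eA.inv ≫ (U s).ι :=
    Proj.awayι_comp_map ψ (irrelevant_le_map hψ) s.1.2 (s.2 : A) s.2.2
  have e : f ∣_ U s = eB.hom ≫ c ≫ eA.inv := by
    rw [← cancel_mono (U s).ι, morphismRestrict_ι, Category.assoc, Category.assoc, ← h,
      Category.assoc, Iso.hom_inv_id_assoc]
  rw [e]
  infer_instance

include hψ in
/-- The image of `Proj` under a surjective homomorphism `ψ` is the zero locus of the kernel. -/
theorem range_projMap :
    Set.range (Proj.map ψ (irrelevant_le_map hψ)) =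
      {x : Proj 𝒜 | RingHom.ker ψ ≤ x.asHomogeneousIdeal.toIdeal} := by
  ext x
  constructor
  · rintro ⟨p, rfl⟩ a ha
    change ψ a ∈ p.asHomogeneousIdeal
    rw [RingHom.mem_ker.1 ha]
    exact zero_mem _
  · intro hx
    have hcomap : (x.asHomogeneousIdeal.toIdeal.map ψ).comap ψ = x.asHomogeneousIdeal.toIdeal := by
      rw [Ideal.comap_map_of_surjective ψ hψ]
      exact sup_eq_left.2 hx
    let p : ProjectiveSpectrum ℬ :=
      { asHomogeneousIdeal := x.asHomogeneousIdeal.map ψ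
        isPrime := by
          have := x.isPrime
          exact Ideal.map_isPrime_of_surjective hψ hx
        not_irrelevant_le h := by
          exact x.not_irrelevant_le (((irrelevant_le (𝒜 := 𝒜)).2 fun i hi a ha =>
            mem_irrelevant_of_mem (𝒜 := ℬ) hi (map_mem ψ ha)).trans
              ((comap_mono ψ h).trans hcomap.le)) }
    refine ⟨p, ?_⟩
    apply ProjectiveSpectrum.ext
    apply HomogeneousIdeal.ext
    exact hcomap

/-- The projective spectrum of a reduced graded ring is a reduced scheme. -/
theorem isReduced_proj [_root_.IsReduced A] : AlgebraicGeometry.IsReduced (Proj 𝒜) := by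
  have : ∀ i, AlgebraicGeometry.IsReduced ((Proj.affineOpenCover 𝒜).openCover.X i) := by
    intro i
    change AlgebraicGeometry.IsReduced (Spec (.of (Away 𝒜 (i.2 : A))))
    rw [affine_isReduced_iff]
    have h1 : _root_.IsReduced (Localization.Away (i.2 : A)) :=
      isReduced_localizationPreserves (Submonoid.powers (i.2 : A)) _ ‹_›
    exact isReduced_of_injective
      (algebraMap (Away 𝒜 (i.2 : A)) (Localization.Away (i.2 : A))) (val_injective _)
  exact AlgebraicGeometry.IsReduced.of_openCover _ (Proj.affineOpenCover 𝒜).openCover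

end Proj

section Base

open HomogeneousLocalization

variable {A B : Type u} [CommRing A] [CommRing B] [Algebra ℂ A] [Algebra ℂ B]
  {𝒜 : ℕ → Submodule ℂ A} {ℬ : ℕ → Submodule ℂ B} [GradedAlgebra 𝒜] [GradedAlgebra ℬ]

/-- A homomorphism of graded rings that fixes the scalars induces a morphism over `Spec ℂ`. -/
theorem projMap_projToBase (ψ : 𝒜 →+*ᵍ ℬ) (hψ : Function.Surjective ψ)
    (h : ∀ r : ℂ, ψ (algebraMap ℂ A r) = algebraMap ℂ B r) :
    Proj.map ψ (irrelevant_le_map hψ) ≫ projToBase 𝒜 = projToBase ℬ := by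
  have key : ∀ (i : ℕ) (hi : 0 < i) (a : A) (ha : a ∈ 𝒜 i),
      Proj.awayι ℬ (ψ a) (Graded.map_mem ψ ha) hi ≫ Proj.map ψ (irrelevant_le_map hψ) ≫
        projToBase 𝒜 = Proj.awayι ℬ (ψ a) (Graded.map_mem ψ ha) hi ≫ projToBase ℬ := by
    intro i hi a ha
    rw [projToBase, projToBase, Proj.awayι_comp_map_assoc _ _ hi _ ha,
      Proj.awayι_toSpecZero_assoc, Proj.awayι_toSpecZero_assoc, ← Spec.map_comp, ← Spec.map_comp,
      ← Spec.map_comp]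
    congr 1
    refine CommRingCat.hom_ext (RingHom.ext fun r => ?_)
    change Away.map ψ a (fromZeroRingHom 𝒜 _ (algebraMap ℂ (𝒜 0) r.down)) =
      fromZeroRingHom ℬ _ (algebraMap ℂ (ℬ 0) r.down)
    refine (HomogeneousLocalization.map_mk ψ _ _).trans (val_injective _ ?_)
    simp only [fromZeroRingHom, val_mk]
    congr 1
    · exact h r.down
    · exact Subtype.ext (map_one ψ)
  exact (Proj.mapAffineOpenCover ψ (irrelevant_le_map hψ)).openCover.hom_ext _ _ fun s =>
    key s.1 s.1.2 s.2 s.2.2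

end Base

/-! ### The projective spectrum of `W^{[*]}` and the orbit closure -/

section Orbit

variable {W : Type u} [AddCommGroup W] [Module ℂ W] [FiniteDimensional ℂ W] {𝔞 : Type*}
  {φ : 𝔞 → Module.End ℂ W} {w : W} {G : Type*} [Group G] {ρ : Representation ℂ G W}
  (hspan : ∀ k, level φ w k = Submodule.span ℂ (Set.range fun g => tensorPow k (ρ g w)))
  (hw : w ≠ 0)

variable (φ w) in
/-- The homomorphism `S^*(W^*) → W^{[*]}` as a homomorphism of graded rings. -/
noncomputable def gradedToLevel : homogPoly W →+*ᵍ levelGrading φ w where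
  __ := (toLevel φ w).toRingHom
  map_mem {k P} hP := by
    change toLevel φ w P ∈ _
    rw [toLevel_coe φ w ⟨P, hP⟩]
    exact lof_mem φ w k _

omit [FiniteDimensional ℂ W] in
theorem gradedToLevel_apply (P : Poly W) : gradedToLevel φ w P = toLevel φ w P := rfl

omit [FiniteDimensional ℂ W] in
include hspan hw in
theorem gradedToLevel_eq_zero_iff {k : ℕ} (P : homogPoly W k) :
    gradedToLevel φ w P = 0 ↔ P ∈ vanishing ρ w k := by
  rw [← ker_toDualLevel hspan hw, LinearMap.mem_ker, gradedToLevel_apply, toLevel_coe]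
  exact (map_eq_zero_iff _ (DirectSum.of_injective (β := DualLevel φ w) k))

include hspan hw in
/-- The algebra `W^{[*]}` is reduced: the nilradical is homogeneous, and a homogeneous element is
zero if and only if all its values, which are complex numbers, at the vectors `g w` vanish. -/
theorem isReduced_levelAlgebra : _root_.IsReduced (LevelAlgebra φ w) := by
  classical
  rw [← nilradical_eq_bot_iff, eq_bot_iff]
  intro x hx
  have hhom : (nilradical (LevelAlgebra φ w)).IsHomogeneous (levelGrading φ w) :=
    (Ideal.IsHomogeneous.bot (levelGrading φ w)).radical
  rw [Ideal.mem_bot, ← DirectSum.sum_support_decompose (levelGrading φ w) x]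
  refine Finset.sum_eq_zero fun k _ => ?_
  obtain ⟨n, hn⟩ := mem_nilradical.1 (hhom k hx)
  obtain ⟨P, hP, e⟩ := exists_mem_map_eq (ψ := gradedToLevel φ w) (toLevel_surjective φ w)
    (SetLike.coe_mem (DirectSum.decompose (levelGrading φ w) x k))
  rw [← e] at hn ⊢
  rw [← map_pow] at hn
  rw [gradedToLevel_eq_zero_iff hspan hw ⟨P ^ n, SetLike.pow_mem_graded n hP⟩,
    mem_vanishing_iff] at hn
  rw [gradedToLevel_eq_zero_iff hspan hw ⟨P, hP⟩, mem_vanishing_iff]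
  intro g hg
  have := hn g hg
  rw [map_pow] at this
  exact eq_zero_of_pow_eq_zero this

omit [FiniteDimensional ℂ W] in
include hspan hw in
/-- The zero locus of the kernel of `S^*(W^*) → W^{[*]}` is the orbit closure. -/
theorem ker_le_iff (x : Proj (homogPoly W)) :
    RingHom.ker (gradedToLevel φ w) ≤ x.asHomogeneousIdeal.toIdeal ↔ x ∈ orbitClosure ρ w := by
  classical
  constructor
  · intro h
    refine (ProjectiveSpectrum.zeroLocus_vanishingIdeal_eq_closure (homogPoly W) _).le ?_
    intro P hP
    rw [SetLike.mem_coe, ← DirectSum.sum_support_decompose (homogPoly W) P]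
    refine sum_mem fun k _ => h ?_
    rw [RingHom.mem_ker]
    refine (gradedToLevel_eq_zero_iff hspan hw (DirectSum.decompose (homogPoly W) P k)).2 ?_
    rw [mem_vanishing_iff]
    intro g hg
    rw [← mem_linePoint (hv := hg) (SetLike.coe_mem _)]
    exact (linePoint (ρ g w) hg).asHomogeneousIdeal.2 k
      ((ProjectiveSpectrum.mem_vanishingIdeal _ _).1 hP _ ⟨g, hg, rfl⟩)
  · intro hx P hP
    rw [← DirectSum.sum_support_decompose (homogPoly W) P]
    refine sum_mem fun k _ => ?_
    refine (gradedToLevel_eq_zero_iff hspan hw (DirectSum.decompose (homogPoly W) P k)).1 ?_ x hx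
    rw [(gradedToLevel φ w).map_directSumDecompose, RingHom.mem_ker.1 hP]
    simp

include hspan hw in
/-- The scheme `Proj W^{[*]}` is isomorphic to `N_w`, over `ℂ`. -/
theorem exists_proj_iso : ∃ e : Proj (levelGrading φ w) ≅ orbitVariety ρ w,
    e.hom ≫ orbitVarietyι ρ w ≫ projToBase (homogPoly W) = projToBase (levelGrading φ w) := by
  have hs : Function.Surjective (gradedToLevel φ w) := toLevel_surjective φ w
  let f := Proj.map (gradedToLevel φ w) (irrelevant_le_map hs)
  have := isReduced_levelAlgebra hspan hw
  have : AlgebraicGeometry.IsReduced (Proj (levelGrading φ w)) := isReduced_proj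
  have : IsClosedImmersion f := isClosedImmersion_projMap hs
  have hι : IsClosedImmersion (orbitVarietyι ρ w) :=
    inferInstanceAs (IsClosedImmersion
      (Scheme.IdealSheafData.vanishingIdeal (orbitClosure ρ w)).subschemeι)
  have hrange : Set.range f = orbitClosure ρ w :=
    (range_projMap hs).trans (Set.ext fun x => ker_le_iff hspan hw x)
  -- both ideal sheaves are those of the reduced structure on the orbit closure
  have hker : (orbitVarietyι ρ w).ker = f.ker := by
    refine (Scheme.IdealSheafData.ker_subschemeι _).trans ?_
    rw [← Scheme.IdealSheafData.map_bot f, ← Scheme.nilradical_eq_bot,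
      ← Scheme.IdealSheafData.vanishingIdeal_top, Scheme.IdealSheafData.map_vanishingIdeal]
    congr 1
    apply TopologicalSpace.Closeds.ext
    simp [hrange, (orbitClosure ρ w).isClosed.closure_eq]
  have := IsClosedImmersion.isIso_lift _ _ hker
  refine ⟨asIso (IsClosedImmersion.lift _ _ hker.le), ?_⟩
  rw [asIso_hom, IsClosedImmersion.lift_fac_assoc]
  exact projMap_projToBase _ hs (toLevel φ w).commutes

end Orbit

end HigherLevel

theorem proposition1p5 {𝕜 : Type*} [RCLike 𝕜] [NormedAlgebra 𝕜 ℂ]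
    {E : Type*} [NormedAddCommGroup E] [NormedSpace 𝕜 E] [CompleteSpace E]
    {G : Type*} [TopologicalSpace G] [ChartedSpace E G] [Group G] [LieGroup 𝓘(𝕜, E) ∞ G]
    [ConnectedSpace G]
    {W : Type*} [NormedAddCommGroup W] [NormedSpace ℂ W] [FiniteDimensional ℂ W]
    [NormedSpace 𝕜 W] [IsScalarTower 𝕜 ℂ W]
    (φ : GroupLieAlgebra 𝓘(𝕜, E) G →ₗ[𝕜] Module.End ℂ W)
    (hφ_lie : ∀ X Y, φ ⁅X, Y⁆ = φ X * φ Y - φ Y * φ X)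
    (ρ : Representation ℂ G W)
    (hρ : ∀ v, ContMDiff 𝓘(𝕜, E) 𝓘(𝕜, W) ∞ fun g => ρ g v)
    (hφ : ∀ X v, φ X v = mfderiv 𝓘(𝕜, E) 𝓘(𝕜, W) (fun g => ρ g v) 1 X)
    (w : W) (hw : w ≠ 0) (hcyc : generated φ w = ⊤) :
    (∃ e : Proj (levelGrading φ w) ≅ orbitVariety ρ w,
      e.hom ≫ orbitVarietyι ρ w ≫ projToBase (homogPoly W) = projToBase (levelGrading φ w)) ∧
    ∃ hstab : ∀ k g, ∀ x ∈ level φ w k, tensorDiag k (ρ g) x ∈ level φ w k,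
    ∃ Θ : ∀ k, level φ w k ≃ₗ[ℂ] Module.Dual ℂ (Sections ρ w k),
      (∀ k g (x : level φ w k),
        Θ k ⟨tensorDiag k (ρ g) x, hstab k g x x.2⟩ = (sectionsRep ρ w k).dual g (Θ k x)) ∧
      ∀ i j (x : level φ w (i + j)) (a : Sections ρ w i) (b : Sections ρ w j),
        Θ (i + j) x (sectionsMul ρ w i j a b) =
          TensorProduct.dualDistrib ℂ _ _
            (TensorProduct.map (Θ i).toLinearMap (Θ j).toLinearMap (comul φ w i j x))
            (a ⊗ₜ b) := by
  have hspan := level_eq_span hρ hφ w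
  exact ⟨exists_proj_iso hspan hw, tensorDiag_mem_level hspan, levelEquiv hspan hw,
    levelEquiv_tensorDiag hspan hw, levelEquiv_mul hspan hw⟩
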